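/- Let $n\ge 1$, $0<\sigma<2$, $\beta\in\mathbb R$, $p>1$, and consider the Cauchy problem $$u_{tt}-\Delta u+\frac{1}{(1+t)^{\beta}}(-\Delta)^{\sigma/2}u_t=|u|^p\quad (t>0,\ x\in\mathbb R^n),\qquad u(0,\cdot)=u_0,\quad u_t(0,\cdot)=u_1 ,\tag{1}$$ for real-valued functions, where $(-\Delta)^{s}\eta(x)=C_{n,s}\,\mathrm{p.v.}\!\int_{\mathbb R^n}\frac{\eta(x)-\eta(y)}{|x-y|^{n+2s}}\,dy$, $C_{n,s}=\frac{s4^s\Gamma(n/2+s)}{\pi^{n/2}\Gamma(1-s)}$ ($0<s<1$) on Schwartz functions, extended to $L^2(\mathbb R^n)$ by duality. For $\delta\in(0,2)$ let $H^\delta(\mathbb R^n)$ be the space of $v\in L^2(\mathbb R^n)$ with $(-\Delta)^{\delta/2}v\in L^2$ if $\delta<1$, with $\nabla v\in L^2$ if $\delta=1$, and with $\nabla v,(-\Delta)^{\delta/2}v\in L^2$ if $\delta>1$, normed by the sum of the $L^2$ norms of the quantities involved (including $v$). For $T>0$ let $X_{\sigma,T}$ be the set of all $\varphi\in C([0,\infty);H^2(\mathbb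 R^n))\cap C^1([0,\infty);H^\sigma(\mathbb R^n))\cap C^2([0,\infty);L^2(\mathbb R^n))$ with support in $Q_T=[0,T]\times\mathbb R^n$. A function $u\in L^1((0,T);L^2(\mathbb R^n))\cap L^p((0,T);L^{2p}(\mathbb R^n))$ is a weak solution of (1) on $[0,T)\times\mathbb R^n$ if for all $\varphi\in X_{\sigma,T}$ $$\int_{Q_T}|u|^p\varphi\,dt\,dx+\int_{\mathbb R^n}u_1\varphi(0,x)\,dx+\int_{\mathbb R^n}u_0(-\Delta)^{\sigma/2}\varphi(0,x)\,dx-\int_{\mathbb R^n}u_0\varphi_t(0,x)\,dx$$ $$=\int_{Q_T}u\varphi_{tt}\,dt\,dx-\int_0^T\!\frac{1}{(1+t)^\beta}\int_{\mathbb R^n}u(-\Delta)^{\sigma/2}\varphi_t\,dx\,dt-\int_{Q_T}u\Delta\varphi\,dt\,dx+\int_0^T\!\frac{\beta}{(1+t)^{\beta+1}}\int_{\mathbb R^n}u(-\Delta)^{\sigma/2}\varphi\,dx\,dt .$$ A global weak solution is a function $u$ on $(0,\infty)\times\mathbb R^n$ which is a weak solution on $[0,T)\times\mathbb R^n$ for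 every $T>0$. **Theorem 1 (Blow-up).** Let $(u_0,u_1)\in(L^1(\mathbb R^n)\cap H^1(\mathbb R^n))\times(L^1(\mathbb R^n)\cap L^2(\mathbb R^n))$ with $\int_{\mathbb R^n}u_1\,dx>0$. Write $(a)_+=\max\{0,a\}$, and read a quotient of a positive number by $0$ in the minima below as $+\infty$. Then (1) has no global weak solution in each of the following cases: - $\sigma\ge 1-\beta$ and $1<p<\min\left\{\frac{n+1}{(n-1)_+},\frac{n}{(n-\sigma)_+}\right\}$; - $\sigma\le 1-\beta$ and $1<p<\min\left\{\frac{n(1-\beta)+\sigma}{(n(1-\beta)-\sigma)_+},\frac{n}{(n-\sigma)_+}\right\}$; - $\sigma\ge 1-\beta$, $\sigma>\frac{2n}{n+1}$, $n\ge2$ and $p=\frac{n+1}{n-1}$; - $n(1+\beta)<\sigma\le 1-\beta$, $n(1-\beta)\neq\sigma$ and $p=\frac{n(1-\beta)+\sigma}{n(1-\beta)-\sigma}$. -/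

import Mathlib

open MeasureTheory Set Filter Topology
open scoped ENNReal ContDiff SchwartzMap

noncomputable section

namespace StructDamp

/-- The Euclidean space `ℝⁿ`. -/
abbrev E (n : ℕ) : Type := EuclideanSpace ℝ (Fin n)

/-- The real Hilbert space `L²(ℝⁿ)`. -/
abbrev L2 (n : ℕ) : Type := Lp ℝ 2 (volume : Measure (E n))

/-- `w` is the weak (distributional) partial derivative `∂ᵢ v`. -/
def IsWeakPartial {n : ℕ} (i : Fin n) (v w : L2 n) : Prop :=
  ∀ η : E n → ℝ, ContDiff ℝ ∞ η → HasCompactSupport η →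
    ∫ x, v x * fderiv ℝ η x (EuclideanSpace.single i 1) = -∫ x, w x * η x

/-- The normalizing constant `C_{n,s} = s 4^s Γ(n/2+s) / (π^{n/2} Γ(1-s))`. -/
def fracConst (n : ℕ) (s : ℝ) : ℝ :=
  s * 4 ^ s * Real.Gamma ((n : ℝ) / 2 + s) / (Real.pi ^ ((n : ℝ) / 2) * Real.Gamma (1 - s))

/-- The pointwise fractional Laplacian
`(-Δ)^s η (x) = C_{n,s} p.v. ∫ (η x - η y) / |x - y|^{n+2s} dy`, for `0 < s < 1`
and `η` a Schwartz function. -/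
def fracLapPV {n : ℕ} (s : ℝ) (η : E n → ℝ) (x : E n) : ℝ :=
  fracConst n s * limUnder (𝓝[>] (0 : ℝ))
    (fun ε : ℝ => ∫ y in {y : E n | ε < ‖x - y‖}, (η x - η y) / ‖x - y‖ ^ ((n : ℝ) + 2 * s))

/-- `w = (-Δ)^s v` for `v, w ∈ L²(ℝⁿ)`, in the sense of distributions:
`⟨w, η⟩ = ⟨v, (-Δ)^s η⟩` for all Schwartz functions `η`. -/
def IsFracLap {n : ℕ} (s : ℝ) (v w : L2 n) : Prop :=
  ∀ η : 𝓢(E n, ℝ), ∫ x, w x * η x = ∫ x, v x * fracLapPV s η x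

/-- There is at most one weak partial derivative in `L²`. -/
theorem IsWeakPartial.unique {n : ℕ} {i : Fin n} {v w w' : L2 n}
    (h : IsWeakPartial i v w) (h' : IsWeakPartial i v w') : w = w' := by
  apply Lp.ext
  refine ae_eq_of_integral_contDiff_smul_eq
    ((Lp.memLp w).locallyIntegrable (by norm_num))
    ((Lp.memLp w').locallyIntegrable (by norm_num)) fun η hη hc => ?_
  have := (h η hη hc).symm.trans (h' η hη hc)
  simpa [mul_comm] using this

/-- There is at most one fractional Laplacian in `L²`. -/
theorem IsFracLap.unique {n : ℕ} {s : ℝ} {v w w' : L2 n}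
    (h : IsFracLap s v w) (h' : IsFracLap s v w') : w = w' := by
  apply Lp.ext
  refine ae_eq_of_integral_contDiff_smul_eq
    ((Lp.memLp w).locallyIntegrable (by norm_num))
    ((Lp.memLp w').locallyIntegrable (by norm_num)) fun η hη hc => ?_
  have := (h (hc.toSchwartzMap hη)).trans (h' (hc.toSchwartzMap hη)).symm
  simpa [mul_comm] using this

open Classical in
/-- The weak partial derivative `∂ᵢ v ∈ L²(ℝⁿ)` (and `0` if there is none in `L²`). -/
def weakPartial {n : ℕ} (i : Fin n) (v : L2 n) : L2 n :=
  if h : ∃ w, IsWeakPartial i v w then h.choose else 0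

open Classical in
/-- `(-Δ)^s v ∈ L²(ℝⁿ)` (and `0` if it is not in `L²`). -/
def fracLap {n : ℕ} (s : ℝ) (v : L2 n) : L2 n :=
  if h : ∃ w, IsFracLap s v w then h.choose else 0

/-- `v ∈ H¹(ℝⁿ)`. -/
def MemH1 {n : ℕ} (v : L2 n) : Prop := ∀ i, ∃ w, IsWeakPartial i v w

/-- `v ∈ H²(ℝⁿ)`. -/
def MemH2 {n : ℕ} (v : L2 n) : Prop := MemH1 v ∧ ∀ i, MemH1 (weakPartial i v)

/-- `v ∈ H^δ(ℝⁿ)` for `0 < δ < 2`: `v` and, if `δ ≠ 1`, `(-Δ)^{δ/2} v` are in `L²`,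
and, if `δ ≥ 1`, moreover `v ∈ H¹`. -/
def MemHfrac {n : ℕ} (δ : ℝ) (v : L2 n) : Prop :=
  (δ ≠ 1 → ∃ w, IsFracLap (δ / 2) v w) ∧ (1 ≤ δ → MemH1 v)

/-- The Laplacian `Δ v = ∑ᵢ ∂ᵢ ∂ᵢ v` of `v ∈ H²(ℝⁿ)`. -/
def lapl {n : ℕ} (v : L2 n) : L2 n := ∑ i, weakPartial i (weakPartial i v)

/-- The test functions
`φ ∈ C([0,∞); H²) ∩ C¹([0,∞); H^δ) ∩ C²([0,∞); L²)` with support in `[0,T] × ℝⁿ`.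
The norms of `H²` and `H^δ` are the sums of the `L²` norms of the listed derivatives, so that
a curve is `C^k` for such a norm iff it and each of these derivatives is `C^k` in `L²`
(the operators `∂ᵢ` and `(-Δ)^{δ/2}` being closed). -/
structure IsTestFunction {n : ℕ} (δ T : ℝ) (φ : ℝ → L2 n) : Prop where
  memH2 : ∀ t ∈ Ici (0 : ℝ), MemH2 (φ t)
  cont : ContinuousOn φ (Ici 0)
  cont_grad : ∀ i, ContinuousOn (fun t => weakPartial i (φ t)) (Ici 0)
  cont_hess : ∀ i j, ContinuousOn (fun t => weakPartial i (weakPartial j (φ t))) (Ici 0)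
  memHfrac : ∀ t ∈ Ici (0 : ℝ), MemHfrac δ (φ t)
  contDiff_one : ContDiffOn ℝ 1 φ (Ici 0)
  contDiff_frac : δ ≠ 1 → ContDiffOn ℝ 1 (fun t => fracLap (δ / 2) (φ t)) (Ici 0)
  contDiff_grad : 1 ≤ δ → ∀ i, ContDiffOn ℝ 1 (fun t => weakPartial i (φ t)) (Ici 0)
  contDiff_two : ContDiffOn ℝ 2 φ (Ici 0)
  support : ∀ t, T < t → φ t = 0

/-- The time derivative on `[0,∞)` (one-sided at `0`) of a curve in `L²`. -/
def dt {n : ℕ} (φ : ℝ → L2 n) : ℝ → L2 n := derivWithin φ (Ici 0)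

/-- `u` is a weak solution on `[0,T) × ℝⁿ` of
`u_tt - Δu + (1+t)^{-β} (-Δ)^{σ/2} u_t = |u|^p`, `u(0) = u₀`, `u_t(0) = u₁`.
The elements of `L^q((0,T); L^r(ℝⁿ))` are represented by jointly measurable functions. -/
structure IsWeakSolution {n : ℕ} (β σ p : ℝ) (u₀ u₁ : L2 n) (T : ℝ) (u : ℝ → E n → ℝ) :
    Prop where
  /-- joint measurability on `(0,T) × ℝⁿ` -/
  meas : AEStronglyMeasurable (Function.uncurry u)
    ((volume.restrict (Ioo 0 T)).prod (volume : Measure (E n)))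
  /-- `u ∈ L¹((0,T); L²)` -/
  memL1L2 : ∫⁻ t in Ioo 0 T, eLpNorm (u t) 2 volume < ⊤
  /-- `u ∈ L^p((0,T); L^{2p})` -/
  memLpL2p : ∫⁻ t in Ioo 0 T, eLpNorm (u t) (ENNReal.ofReal (2 * p)) volume ^ p < ⊤
  /-- the weak formulation -/
  weak : ∀ φ : ℝ → L2 n, IsTestFunction σ T φ →
    (∫ t in Ioo 0 T, ∫ x, |u t x| ^ p * φ t x) + (∫ x, u₁ x * φ 0 x)
        + (∫ x, u₀ x * fracLap (σ / 2) (φ 0) x) - (∫ x, u₀ x * dt φ 0 x)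
      = (∫ t in Ioo 0 T, ∫ x, u t x * dt (dt φ) t x)
        - (∫ t in Ioo 0 T, 1 / (1 + t) ^ β * ∫ x, u t x * fracLap (σ / 2) (dt φ t) x)
        - (∫ t in Ioo 0 T, ∫ x, u t x * lapl (φ t) x)
        + (∫ t in Ioo 0 T, β / (1 + t) ^ (β + 1) * ∫ x, u t x * fracLap (σ / 2) (φ t) x)

/-- `u` is a global weak solution: a weak solution on `[0,T) × ℝⁿ` for every `T > 0`. -/
def IsGlobalWeakSolution {n : ℕ} (β σ p : ℝ) (u₀ u₁ : L2 n) (u : ℝ → E n → ℝ) : Prop :=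
  ∀ T : ℝ, 0 < T → IsWeakSolution β σ p u₀ u₁ T u

/-- `a / (b)₊` in `[0,∞]`, where `(b)₊ = max {0, b}`; it is `∞` if `a > 0` and `b ≤ 0`. -/
def divPos (a b : ℝ) : ℝ≥0∞ := ENNReal.ofReal a / ENNReal.ofReal (max 0 b)

end StructDamp

end

noncomputable section

namespace StructDamp

/-! The proof is a test function argument. Test the weak formulation with `η(t/T) ψ(x/R)`, where `R
= K T^κ`, and let `q = p/(p-1)`. Since `(-Δ)^(σ/2)` is nonlocal, `ψ` cannot be a compactly supported
bump: it must be positive with `|(-Δ)^(σ/2) ψ| ≤ C ψ`. The power `(1+|x|²)^(-(n+σ)/2)`, which decays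
exactly like the singular kernel, has this property (`exists_isProfile`). Likewise `η` is a high
power of a smooth cutoff, so that `|η'|` and `|η''|` are bounded by `η^(1/p)` (`exists_isCutoff`).
All terms linear in `u` are then bounded by integrals of `|u|` against the test function, and
Young's inequality absorbs them into the integral of `|u|^p`.

The remainders are powers of `T` and `K`. The conditions `κ ≥ 1`, `σκ ≥ 1-β` and `1+nκ ≤ 2q` make
them bounded in `T`, and `n < σq` handles the term with the derivative of `(1+t)^(-β)`, which lives
on all of `[0,T]`. Each range of `p` in the theorem yields such a `κ` (`exists_scaling_exponent`).

Critical and subcritical cases are treated together. In `exists_energy_estimate` the terms with `η'`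
and `η''`, supported in `t ≥ T/2`, get their own Young weight `c`; they cost `c` times a tail of the
integral of `|u|^p`, plus `c^(1-q) K^n`. The other terms cost `K^(-(σq-n))`. With `K = 1` the
estimate gives `|u|^p ∈ L¹` in space-time (`IsGlobalWeakSolution.lintegral_lt_top`), so the tail
vanishes as `T → ∞`. Letting then `c → ∞` and finally `K → ∞` leaves `∫ u₁ ≤ 0`
(`IsGlobalWeakSolution.integral_nonpos`), a contradiction. -/

/-! ### Second differences and the fractional Laplacian. -/

/-- The second difference `2 f(x) - f(x+h) - f(x-h)`. -/
def secondDiff {n : ℕ} (f : E n → ℝ) (x h : E n) : ℝ := 2 * f x - f (x + h) - f (x - h)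

/-- The fractional Laplacian as an absolutely convergent integral of second differences. -/
def symmFracLap {n : ℕ} (s : ℝ) (f : E n → ℝ) (x : E n) : ℝ :=
  fracConst n s / 2 * ∫ h, secondDiff f x h / ‖h‖ ^ ((n : ℝ) + 2 * s)

theorem abs_taylor_one_le {n : ℕ} {f : E n → ℝ} (hf : ContDiff ℝ 2 f) {x h : E n} {M : ℝ}
    (hM : ∀ y ∈ segment ℝ x (x + h), ‖fderiv ℝ (fderiv ℝ f) y‖ ≤ M) :
    |f (x + h) - f x - fderiv ℝ f x h| ≤ M * ‖h‖ ^ 2 := by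
  have hx : x ∈ segment ℝ x (x + h) := left_mem_segment ℝ _ _
  have hxh : x + h ∈ segment ℝ x (x + h) := right_mem_segment ℝ _ _
  have hd : Differentiable ℝ f := hf.differentiable (by norm_num)
  have hd' : Differentiable ℝ (fderiv ℝ f) :=
    (hf.fderiv_right (m := 1) (by norm_num)).differentiable (by norm_num)
  have hM0 : 0 ≤ M := le_trans (by positivity) (hM x hx)
  have h1 : ∀ y ∈ segment ℝ x (x + h), ‖fderiv ℝ f y - fderiv ℝ f x‖ ≤ M * ‖h‖ := by
    intro y hy
    refine ((convex_segment x (x + h)).norm_image_sub_le_of_norm_fderiv_le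
      (fun z _ => hd' z) hM hx hy).trans ?_
    gcongr
    obtain ⟨t, ht, rfl⟩ := (segment_eq_image' ℝ x (x + h)) ▸ hy
    simp only [add_sub_cancel_left, norm_smul, Real.norm_eq_abs, abs_of_nonneg ht.1]
    exact mul_le_of_le_one_left (norm_nonneg _) ht.2
  have := (convex_segment x (x + h)).norm_image_sub_le_of_norm_fderiv_le'
      (fun z _ => hd z) h1 hx hxh
  simpa [pow_two, mul_assoc] using this

/-- The first-order Taylor terms at `h` and `-h` cancel. Only the ball of radius `‖h‖` matters; this
locality is needed to get weighted bounds for the profile. -/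
theorem abs_secondDiff_le {n : ℕ} {f : E n → ℝ} (hf : ContDiff ℝ 2 f) {x h : E n} {M : ℝ}
    (hM : ∀ y ∈ Metric.closedBall x ‖h‖, ‖fderiv ℝ (fderiv ℝ f) y‖ ≤ M) :
    |secondDiff f x h| ≤ 2 * M * ‖h‖ ^ 2 := by
  have key : ∀ k : E n, ‖k‖ = ‖h‖ → |f (x + k) - f x - fderiv ℝ f x k| ≤ M * ‖h‖ ^ 2 := by
    intro k hk
    rw [← hk]
    refine abs_taylor_one_le hf fun y hy => hM y ?_
    refine (convex_closedBall x ‖h‖).segment_subset (by simp) (by simp [hk]) hy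
  have h1 := key h rfl
  have h2 := key (-h) (norm_neg h)
  rw [map_neg, ← sub_eq_add_neg] at h2
  unfold secondDiff
  rw [abs_le] at *
  constructor <;> linarith

theorem secondDiff_continuous {n : ℕ} {f : E n → ℝ} (hf : Continuous f) :
    Continuous fun z : E n × E n => secondDiff f z.1 z.2 := by
  unfold secondDiff; fun_prop

/-- In polar coordinates the integrand is `r^(1-2s)` near `0` and `r^(-1-2s)` at infinity, which is
where `s < 1` and `0 < s` enter. This is the universal majorant for second differences divided by
the kernel. -/
theorem integrable_min_sq_div_norm_rpow {n : ℕ} (hn : 1 ≤ n) {s : ℝ} (hs₀ : 0 < s) (hs₁ : s < 1) :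
    Integrable (fun h : E n => min (‖h‖ ^ 2) 1 / ‖h‖ ^ ((n : ℝ) + 2 * s)) := by
  have : Nonempty (Fin n) := ⟨⟨0, hn⟩⟩
  have : Nontrivial (E n) := by
    infer_instance
  have := (integrable_fun_norm_addHaar (volume : Measure (E n))
    (f := fun r : ℝ => min (r ^ 2) 1 / r ^ ((n : ℝ) + 2 * s))).2 ?_
  · exact this
  rw [finrank_euclideanSpace_fin, ← Ioc_union_Ioi_eq_Ioi (zero_le_one (α := ℝ))]
  have hpow : ∀ r : ℝ, 0 < r → r ^ (n - 1) = r ^ ((n : ℝ) - 1) := by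
    intro r hr
    rw [← Real.rpow_natCast, Nat.cast_sub hn, Nat.cast_one]
  refine IntegrableOn.union ?_ ?_
  · have h1 : IntegrableOn (fun r : ℝ => r ^ (1 - 2 * s)) (Ioc 0 1) := by
      rw [← intervalIntegrable_iff_integrableOn_Ioc_of_le zero_le_one]
      exact intervalIntegral.intervalIntegrable_rpow' (by linarith)
    refine h1.congr_fun (fun r hr => ?_) measurableSet_Ioc
    have hr0 : 0 < r := hr.1
    have : min (r ^ 2) 1 = r ^ (2 : ℝ) := by
      rw [min_eq_left (pow_le_one₀ hr0.le hr.2)]; norm_cast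
    simp only [smul_eq_mul]
    rw [this, hpow r hr0, ← Real.rpow_sub hr0, ← Real.rpow_add hr0]
    ring_nf
  · have h1 : IntegrableOn (fun r : ℝ => r ^ (-1 - 2 * s)) (Ioi 1) :=
      integrableOn_Ioi_rpow_of_lt (by linarith) one_pos
    refine h1.congr_fun (fun r hr => ?_) measurableSet_Ioi
    have hr1 : 1 < r := hr
    have hr0 : 0 < r := by linarith
    have : min (r ^ 2) 1 = 1 := min_eq_right (one_le_pow₀ hr1.le)
    simp only [smul_eq_mul]
    rw [this, hpow r hr0, one_div, ← Real.rpow_neg hr0.le, ← Real.rpow_add hr0]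
    ring_nf

theorem integrable_secondDiff_div {n : ℕ} (hn : 1 ≤ n) {s : ℝ} (hs₀ : 0 < s) (hs₁ : s < 1)
    {f : E n → ℝ} (hf : Continuous f) {C : ℝ} (x : E n)
    (hC : ∀ h, |secondDiff f x h| ≤ C * min (‖h‖ ^ 2) 1) :
    Integrable (fun h => secondDiff f x h / ‖h‖ ^ ((n : ℝ) + 2 * s)) := by
  refine ((integrable_min_sq_div_norm_rpow hn hs₀ hs₁).const_mul C).mono' ?_ ?_
  · have : Continuous fun h => secondDiff f x h := by unfold secondDiff; fun_prop
    exact (this.measurable.div (by fun_prop)).aestronglyMeasurable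
  · refine Eventually.of_forall fun h => ?_
    rw [Real.norm_eq_abs, abs_div, abs_of_nonneg (Real.rpow_nonneg (norm_nonneg h) _),
      ← mul_div_assoc]
    gcongr
    exact hC h

/-- Averaging the truncated integral over `h` and `-h` turns the first difference into half a second
difference, whose quotient by the kernel is absolutely integrable; dominated convergence then
removes the truncation. -/
theorem fracLapPV_eq_symmFracLap {n : ℕ} (hn : 1 ≤ n) {s : ℝ} (hs₀ : 0 < s) (hs₁ : s < 1)
    {f : E n → ℝ} (hf : Continuous f) {M : ℝ} (hM : ∀ x, |f x| ≤ M) {C : ℝ} (x : E n)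
    (hC : ∀ h, |secondDiff f x h| ≤ C * min (‖h‖ ^ 2) 1) :
    fracLapPV s f x = symmFracLap s f x := by
  set a : ℝ := (n : ℝ) + 2 * s with ha
  have ha0 : 0 < a := by positivity
  set g : E n → ℝ := fun h => (f x - f (x + h)) / ‖h‖ ^ a with hg
  have hgm : Measurable g := by
    have : Continuous fun h => f x - f (x + h) := by fun_prop
    exact this.measurable.div (by fun_prop)
  have hint := integrable_secondDiff_div hn hs₀ hs₁ hf x hC
  have hmeas : ∀ ε : ℝ, MeasurableSet {h : E n | ε < ‖h‖} := fun ε =>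
    measurableSet_lt measurable_const measurable_norm
  -- Away from the singularity the weight `min (‖h‖ ^ 2) 1` is at least `min (ε ^ 2) 1`, so a
  -- bounded numerator is a multiple of it.
  have hgint : ∀ ε : ℝ, 0 < ε → IntegrableOn g {h | ε < ‖h‖} := by
    intro ε hε
    refine (((integrable_min_sq_div_norm_rpow hn hs₀ hs₁).const_mul
      (2 * M * (min (ε ^ 2) 1)⁻¹)).integrableOn).mono' hgm.aestronglyMeasurable ?_
    rw [ae_restrict_iff' (hmeas ε)]
    refine Eventually.of_forall fun h hh => ?_
    have hh' : ε < ‖h‖ := hh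
    have hpos : 0 < min (ε ^ 2) 1 := lt_min (by positivity) one_pos
    have hmin : min (ε ^ 2) 1 ≤ min (‖h‖ ^ 2) 1 := min_le_min (by gcongr) le_rfl
    rw [hg, Real.norm_eq_abs, abs_div, abs_of_nonneg (Real.rpow_nonneg (norm_nonneg h) _),
      ← mul_div_assoc]
    gcongr
    have h1 : |f x - f (x + h)| ≤ 2 * M := by
      have h2 := abs_sub (f x) (f (x + h))
      linarith [hM x, hM (x + h)]
    have h0 : 0 ≤ M := (abs_nonneg _).trans (hM x)
    calc |f x - f (x + h)| ≤ 2 * M * 1 := by linarith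
      _ = 2 * M * ((min (ε ^ 2) 1)⁻¹ * min (ε ^ 2) 1) := by rw [inv_mul_cancel₀ hpos.ne']
      _ ≤ 2 * M * ((min (ε ^ 2) 1)⁻¹ * min (‖h‖ ^ 2) 1) := by gcongr
      _ = _ := by ring
  have key : ∀ ε : ℝ, 0 < ε →
      ∫ y in {y : E n | ε < ‖x - y‖}, (f x - f y) / ‖x - y‖ ^ a
        = 1 / 2 * ∫ h, {h : E n | ε < ‖h‖}.indicator (fun h => secondDiff f x h / ‖h‖ ^ a) h := by
    intro ε hε
    have hi : Integrable ({h : E n | ε < ‖h‖}.indicator g) :=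
      (integrable_indicator_iff (hmeas ε)).2 (hgint ε hε)
    have hm2 : MeasurableSet {y : E n | ε < ‖x - y‖} :=
      measurableSet_lt measurable_const (by fun_prop)
    have e1 : ∫ y in {y : E n | ε < ‖x - y‖}, (f x - f y) / ‖x - y‖ ^ a
        = ∫ h, {h : E n | ε < ‖h‖}.indicator g h := by
      rw [← integral_indicator hm2, ← integral_add_left_eq_self _ x]
      congr 1; ext h
      simp only [indicator, mem_ofPred_eq, hg]
      simp
    have e2 : ∫ h, {h : E n | ε < ‖h‖}.indicator g (-h)
        = ∫ h, {h : E n | ε < ‖h‖}.indicator g h :=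
      integral_neg_eq_self _ volume
    have e3 : ∫ h, {h : E n | ε < ‖h‖}.indicator (fun h => secondDiff f x h / ‖h‖ ^ a) h
        = (∫ h, {h : E n | ε < ‖h‖}.indicator g h)
          + ∫ h, {h : E n | ε < ‖h‖}.indicator g (-h) := by
      rw [← integral_add hi hi.comp_neg]
      congr 1; ext h
      simp only [indicator, mem_ofPred_eq, hg, norm_neg]
      split_ifs
      · unfold secondDiff; rw [← sub_eq_add_neg]; ring
      · simp
    rw [e1, e3, e2]; ring
  have hlim : Tendsto (fun ε : ℝ =>
      ∫ y in {y : E n | ε < ‖x - y‖}, (f x - f y) / ‖x - y‖ ^ a) (𝓝[>] 0)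
      (𝓝 (1 / 2 * ∫ h, secondDiff f x h / ‖h‖ ^ a)) := by
    refine Tendsto.congr' (f₁ := fun ε : ℝ => 1 / 2 *
      ∫ h, {h : E n | ε < ‖h‖}.indicator (fun h => secondDiff f x h / ‖h‖ ^ a) h) ?_ ?_
    · filter_upwards [self_mem_nhdsWithin] with ε hε
      exact (key ε hε).symm
    refine Tendsto.const_mul _ ?_
    refine tendsto_integral_filter_of_dominated_convergence
      (fun h => ‖secondDiff f x h / ‖h‖ ^ a‖) ?_ ?_ hint.norm ?_
    · exact Eventually.of_forall fun ε => hint.aestronglyMeasurable.indicator (hmeas ε)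
    · exact Eventually.of_forall fun ε => Eventually.of_forall fun h =>
        norm_indicator_le_norm_self _ _
    · refine Eventually.of_forall fun h => ?_
      rcases eq_or_ne h 0 with rfl | hh
      · have : secondDiff f x 0 = 0 := by simp [secondDiff]; ring
        simp [indicator, this]
      · refine tendsto_const_nhds.congr' ?_
        have : Iio ‖h‖ ∈ 𝓝[>] (0 : ℝ) := nhdsWithin_le_nhds (Iio_mem_nhds (norm_pos_iff.2 hh))
        filter_upwards [this] with ε hε
        rw [indicator_of_mem]
        exact hε
  unfold fracLapPV symmFracLap
  rw [hlim.limUnder_eq]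
  ring

/-- Translation invariance exchanges the shifts by `h` and `-h`, and the second difference is
symmetric in them. -/
theorem integral_mul_secondDiff_comm {n : ℕ} {f g : E n → ℝ} (hf : Continuous f)
    (hg : Continuous g) (hfi : Integrable f) (hgi : Integrable g) {M : ℝ} (hMf : ∀ x, |f x| ≤ M)
    (hMg : ∀ x, |g x| ≤ M) (h : E n) :
    ∫ x, f x * secondDiff g x h = ∫ x, g x * secondDiff f x h := by
  have i0 : ∀ {f g : E n → ℝ} (k : E n), Continuous g → Integrable f → (∀ x, |g x| ≤ M) →
      Integrable fun x => f x * g (x + k) := by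
    intro f g k hg hfi hMg
    refine hfi.mul_bdd (c := M) ?_ (Eventually.of_forall fun x => by
      simpa using hMg (x + k))
    exact (hg.comp (by fun_prop)).aestronglyMeasurable
  have e0 : ∀ {f g : E n → ℝ}, Continuous g → Integrable f → (∀ x, |g x| ≤ M) →
      ∫ x, f x * secondDiff g x h
        = 2 * (∫ x, f x * g x) - (∫ x, f x * g (x + h)) - ∫ x, f x * g (x - h) := by
    intro f g hg hfi hMg
    have i1 := i0 0 hg hfi hMg
    have i2 := i0 h hg hfi hMg
    have i3 := i0 (-h) hg hfi hMg
    simp only [add_zero, ← sub_eq_add_neg] at i1 i3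
    have i4 : Integrable fun x => 2 * (f x * g x) - f x * g (x + h) := (i1.const_mul 2).sub i2
    rw [← integral_const_mul, ← integral_sub (i1.const_mul 2) i2, ← integral_sub i4 i3]
    congr 1; ext x; unfold secondDiff; ring
  rw [e0 hg hfi hMg, e0 hf hgi hMf]
  have s1 : ∫ x, f x * g (x + h) = ∫ x, g x * f (x - h) := by
    rw [← integral_sub_right_eq_self _ h]
    simp [mul_comm]
  have s2 : ∫ x, f x * g (x - h) = ∫ x, g x * f (x + h) := by
    rw [← integral_add_right_eq_self _ h]
    simp [mul_comm]
  rw [s1, s2]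
  simp_rw [mul_comm (f _) (g _)]
  ring

/-- Symmetry of the fractional Laplacian on integrable functions of class `C^{1,1}`. -/
theorem integral_mul_symmFracLap_comm {n : ℕ} (hn : 1 ≤ n) {s : ℝ} (hs₀ : 0 < s) (hs₁ : s < 1)
    {f g : E n → ℝ} (hf : Continuous f) (hg : Continuous g) (hfi : Integrable f)
    (hgi : Integrable g) {M : ℝ} (hMf : ∀ x, |f x| ≤ M) (hMg : ∀ x, |g x| ≤ M) {C : ℝ}
    (hCf : ∀ x h, |secondDiff f x h| ≤ C * min (‖h‖ ^ 2) 1)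
    (hCg : ∀ x h, |secondDiff g x h| ≤ C * min (‖h‖ ^ 2) 1) :
    ∫ x, f x * symmFracLap s g x = ∫ x, g x * symmFracLap s f x := by
  set a : ℝ := (n : ℝ) + 2 * s with ha
  have hprod : ∀ {f g : E n → ℝ}, Continuous f → Continuous g → Integrable f →
      (∀ x h, |secondDiff g x h| ≤ C * min (‖h‖ ^ 2) 1) →
      Integrable (fun z : E n × E n => f z.1 * (secondDiff g z.1 z.2 / ‖z.2‖ ^ a))
        (volume.prod volume) := by
    intro f g hf hg hfi hCg
    refine (hfi.norm.mul_prod ((integrable_min_sq_div_norm_rpow hn hs₀ hs₁).const_mul C)).mono'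
      ?_ ?_
    · refine Measurable.aestronglyMeasurable ?_
      exact (hf.measurable.comp measurable_fst).mul
        ((secondDiff_continuous hg).measurable.div (by fun_prop))
    · refine Eventually.of_forall fun z => ?_
      rw [norm_mul, Real.norm_eq_abs (secondDiff _ _ _ / _), abs_div,
        abs_of_nonneg (Real.rpow_nonneg (norm_nonneg z.2) _), ← mul_div_assoc C]
      refine mul_le_mul_of_nonneg_left ?_ (norm_nonneg (f z.1))
      gcongr
      exact hCg _ _
  have hE : ∀ {f g : E n → ℝ}, Continuous f → Continuous g → Integrable f →
      (∀ x h, |secondDiff g x h| ≤ C * min (‖h‖ ^ 2) 1) →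
      ∫ x, f x * symmFracLap s g x
        = fracConst n s / 2 * ∫ h, (∫ x, f x * secondDiff g x h) / ‖h‖ ^ a := by
    intro f g hf hg hfi hCg
    have := integral_integral_swap
      (f := fun x h => f x * (secondDiff g x h / ‖h‖ ^ a)) (hprod hf hg hfi hCg)
    simp only [← mul_div_assoc, integral_div] at this
    rw [← this, ← integral_const_mul]
    congr 1; ext x
    unfold symmFracLap
    simp_rw [mul_div_assoc, integral_const_mul]
    ring
  rw [hE hf hg hfi hCg, hE hg hf hgi hCf]
  simp_rw [integral_mul_secondDiff_comm hf hg hfi hgi hMf hMg]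

theorem abs_secondDiff_le_min {n : ℕ} {f : E n → ℝ} (hf : ContDiff ℝ 2 f) {M : ℝ}
    (hM : ∀ x, |f x| ≤ M) (hM' : ∀ x, ‖fderiv ℝ (fderiv ℝ f) x‖ ≤ M) (x h : E n) :
    |secondDiff f x h| ≤ 4 * M * min (‖h‖ ^ 2) 1 := by
  have h0 : 0 ≤ M := (abs_nonneg _).trans (hM x)
  have h1 := abs_secondDiff_le hf (x := x) (h := h) (fun y _ => hM' y)
  have h2 : |secondDiff f x h| ≤ 4 * M := by
    unfold secondDiff
    have a := abs_le.1 (hM x)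
    have b := abs_le.1 (hM (x + h))
    have c := abs_le.1 (hM (x - h))
    rw [abs_le]; constructor <;> linarith
  rw [mul_min_of_nonneg _ _ (by positivity)]
  refine le_min (h1.trans ?_) (by simpa using h2)
  gcongr
  norm_num

theorem schwartz_bounds {n : ℕ} (η : 𝓢(E n, ℝ)) :
    ∃ M : ℝ, (∀ x, |η x| ≤ M) ∧ ∀ x, ‖fderiv ℝ (fderiv ℝ η) x‖ ≤ M := by
  obtain ⟨A, hA⟩ := η.decay 0 0
  obtain ⟨B, hB⟩ := (SchwartzMap.fderivCLM ℝ (E n) ℝ η).decay 0 1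
  refine ⟨max A B, fun x => le_max_of_le_left ?_, fun x => le_max_of_le_right ?_⟩
  · simpa using hA.2 x
  · have := hB.2 x
    rw [← norm_iteratedFDeriv_fderiv, norm_iteratedFDeriv_zero] at this
    simp only [pow_zero, one_mul] at this
    exact this

/-- For an integrable function of class `C²`, bounded with bounded second derivative, the
distributional fractional Laplacian is given by second differences. -/
theorem isFracLap_of_ae_eq {n : ℕ} (hn : 1 ≤ n) {s : ℝ} (hs₀ : 0 < s) (hs₁ : s < 1)
    {f : E n → ℝ} (hf : ContDiff ℝ 2 f) (hfi : Integrable f) {M : ℝ} (hM : ∀ x, |f x| ≤ M)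
    (hM' : ∀ x, ‖fderiv ℝ (fderiv ℝ f) x‖ ≤ M) {v w : L2 n} (hv : v =ᵐ[volume] f)
    (hw : w =ᵐ[volume] symmFracLap s f) : IsFracLap s v w := by
  intro η
  obtain ⟨A, hA, hA'⟩ := schwartz_bounds η
  have e1 : ∫ x, w x * η x = ∫ x, η x * symmFracLap s f x := by
    refine integral_congr_ae ?_
    filter_upwards [hw] with x hx
    rw [hx, mul_comm]
  have e2 : ∫ x, v x * fracLapPV s η x = ∫ x, f x * symmFracLap s η x := by
    refine integral_congr_ae ?_
    filter_upwards [hv] with x hx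
    rw [hx, fracLapPV_eq_symmFracLap hn hs₀ hs₁ η.continuous hA x
      (abs_secondDiff_le_min (η.smooth 2) hA hA' x)]
  rw [e1, e2]
  set B := max A M
  have hAB : A ≤ B := le_max_left _ _
  have hMB : M ≤ B := le_max_right _ _
  exact integral_mul_symmFracLap_comm hn hs₀ hs₁ η.continuous hf.continuous η.integrable hfi
    (M := B) (fun x => (hA x).trans hAB) (fun x => (hM x).trans hMB) (C := 4 * B)
    (abs_secondDiff_le_min (η.smooth 2) (fun x => (hA x).trans hAB) fun x => (hA' x).trans hAB)
    (abs_secondDiff_le_min hf (fun x => (hM x).trans hMB) fun x => (hM' x).trans hMB)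

/-! ### The profile: a power of `1 + |x|²` dominating its own fractional Laplacian. -/

/-- The function `(1 + |x|²)^(-q/2)`. -/
def bracket {n : ℕ} (q : ℝ) (x : E n) : ℝ := (1 + ‖x‖ ^ 2) ^ (-q / 2)

theorem bracket_pos {n : ℕ} (q : ℝ) (x : E n) : 0 < bracket q x := by
  unfold bracket; positivity

theorem bracket_le_one {n : ℕ} {q : ℝ} (hq : 0 ≤ q) (x : E n) : bracket q x ≤ 1 :=
  Real.rpow_le_one_of_one_le_of_nonpos (by nlinarith [sq_nonneg ‖x‖]) (by linarith)

theorem bracket_contDiff {n : ℕ} (q : ℝ) : ContDiff ℝ 2 (bracket q : E n → ℝ) := by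
  unfold bracket
  refine ContDiff.rpow_const_of_ne ?_ fun x => by positivity
  exact contDiff_const.add (contDiff_norm_sq ℝ)

theorem bracket_integrable {n : ℕ} {q : ℝ} (hq : (n : ℝ) < q) :
    Integrable (bracket q : E n → ℝ) :=
  integrable_rpow_neg_one_add_norm_sq (by simpa using hq)

/-- The inner product as a continuous bilinear map. -/
def innerBilin (n : ℕ) : E n →L[ℝ] E n →L[ℝ] ℝ :=
  (innerₗ (E n)).mkContinuous₂ 1 fun x y => by
    simpa using norm_inner_le_norm (𝕜 := ℝ) x y

theorem norm_innerBilin_apply_le {n : ℕ} (x : E n) : ‖innerBilin n x‖ ≤ ‖x‖ :=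
  ContinuousLinearMap.opNorm_le_bound _ (norm_nonneg x) fun y => norm_inner_le_norm (𝕜 := ℝ) x y

theorem norm_innerBilin_le (n : ℕ) : ‖innerBilin n‖ ≤ 1 :=
  ContinuousLinearMap.opNorm_le_bound _ zero_le_one fun x => by
    simpa using norm_innerBilin_apply_le x

theorem hasFDerivAt_one_add_norm_sq_rpow {n : ℕ} (a : ℝ) (x : E n) :
    HasFDerivAt (fun x : E n => (1 + ‖x‖ ^ 2) ^ a)
      ((2 * a * (1 + ‖x‖ ^ 2) ^ (a - 1)) • innerBilin n x) x := by
  have h1 : HasFDerivAt (fun x : E n => 1 + ‖x‖ ^ 2) ((2 : ℝ) • innerBilin n x) x := by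
    refine ((hasStrictFDerivAt_norm_sq x).hasFDerivAt.const_add 1).congr_fderiv ?_
    ext y
    simp [innerBilin]
  refine (h1.rpow_const (p := a) (Or.inl (by positivity))).congr_fderiv ?_
  rw [smul_smul]
  congr 1
  ring

theorem fderiv_bracket {n : ℕ} (q : ℝ) :
    fderiv ℝ (bracket q : E n → ℝ)
      = fun x => (-q * (1 + ‖x‖ ^ 2) ^ (-q / 2 - 1)) • innerBilin n x := by
  ext1 x
  rw [show (bracket q : E n → ℝ) = fun x => (1 + ‖x‖ ^ 2) ^ (-q / 2) from rfl,
    (hasFDerivAt_one_add_norm_sq_rpow (-q / 2) x).fderiv]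
  congr 2
  ring

theorem one_add_norm_sq_rpow_sub_one_mul_le {n : ℕ} (a : ℝ) (x : E n) {c : ℝ}
    (hc : c ≤ 1 + ‖x‖ ^ 2) : (1 + ‖x‖ ^ 2) ^ (a - 1) * c ≤ (1 + ‖x‖ ^ 2) ^ a := by
  have h0 : 0 < 1 + ‖x‖ ^ 2 := by positivity
  rw [Real.rpow_sub_one h0.ne']
  calc _ ≤ (1 + ‖x‖ ^ 2) ^ a / (1 + ‖x‖ ^ 2) * (1 + ‖x‖ ^ 2) := by gcongr
    _ = _ := by field_simp

theorem norm_fderiv_bracket_le {n : ℕ} {q : ℝ} (hq : 0 ≤ q) (x : E n) :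
    ‖fderiv ℝ (bracket q) x‖ ≤ q * bracket q x := by
  have h0 : 0 < 1 + ‖x‖ ^ 2 := by positivity
  rw [fderiv_bracket]
  simp only
  rw [norm_smul, norm_mul, norm_neg, Real.norm_of_nonneg hq,
    Real.norm_of_nonneg (Real.rpow_nonneg h0.le _), mul_assoc]
  gcongr
  refine (mul_le_mul_of_nonneg_left (norm_innerBilin_apply_le x) (by positivity)).trans ?_
  exact one_add_norm_sq_rpow_sub_one_mul_le _ _ (by nlinarith [sq_nonneg (‖x‖ - 1)])

theorem norm_fderiv_fderiv_bracket_le {n : ℕ} {q : ℝ} (hq : 0 ≤ q) (x : E n) :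
    ‖fderiv ℝ (fderiv ℝ (bracket q)) x‖ ≤ (q * (q + 3)) * bracket q x := by
  have h0 : 0 < 1 + ‖x‖ ^ 2 := by positivity
  set v := 1 + ‖x‖ ^ 2 with hv
  have h1 : HasFDerivAt (fun x : E n => -q * (1 + ‖x‖ ^ 2) ^ (-q / 2 - 1))
      ((q * (q + 2) * v ^ (-q / 2 - 2)) • innerBilin n x) x := by
    refine ((hasFDerivAt_one_add_norm_sq_rpow (-q / 2 - 1) x).const_mul (-q)).congr_fderiv ?_
    rw [smul_smul, ← hv, show -q / 2 - 1 - 1 = -q / 2 - 2 by ring]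
    congr 1
    ring
  have h2 := h1.fun_smul (innerBilin n).hasFDerivAt
  rw [fderiv_bracket, h2.fderiv]
  have b1 : ‖(-q * v ^ (-q / 2 - 1)) • innerBilin n‖ ≤ q * bracket q x := by
    refine (ContinuousLinearMap.opNorm_smul_le _ _).trans ?_
    rw [norm_mul, norm_neg, Real.norm_of_nonneg hq,
      Real.norm_of_nonneg (Real.rpow_nonneg h0.le _), mul_assoc]
    gcongr
    refine (mul_le_mul_of_nonneg_left (norm_innerBilin_le n) (by positivity)).trans ?_
    exact one_add_norm_sq_rpow_sub_one_mul_le _ _ (by nlinarith [sq_nonneg ‖x‖])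
  have b2 : ‖((q * (q + 2) * v ^ (-q / 2 - 2)) • innerBilin n x).smulRight (innerBilin n x)‖
      ≤ q * (q + 2) * bracket q x := by
    rw [ContinuousLinearMap.norm_smulRight_apply, norm_smul, norm_mul,
      Real.norm_of_nonneg (Real.rpow_nonneg h0.le _), Real.norm_of_nonneg (by positivity),
      mul_assoc, mul_assoc]
    gcongr
    have hi := norm_innerBilin_apply_le x
    have h3 : v ^ (-q / 2 - 2) * (‖innerBilin n x‖ * ‖innerBilin n x‖)
        ≤ v ^ (-q / 2 - 2) * v := by
      gcongr
      calc _ ≤ ‖x‖ * ‖x‖ := by gcongr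
        _ ≤ v := by rw [hv]; nlinarith
    refine h3.trans ?_
    have h4 := one_add_norm_sq_rpow_sub_one_mul_le (-q / 2 - 1) x (le_refl (1 + ‖x‖ ^ 2))
    have h5 := one_add_norm_sq_rpow_sub_one_mul_le (-q / 2) x
      (c := 1) (by nlinarith [sq_nonneg ‖x‖])
    rw [show -q / 2 - 1 - 1 = -q / 2 - 2 by ring] at h4
    rw [mul_one] at h5
    exact h4.trans h5
  refine (ContinuousLinearMap.opNorm_add_le _ _).trans ?_
  calc _ ≤ q * bracket q x + q * (q + 2) * bracket q x := add_le_add b1 b2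
    _ = _ := by ring

theorem bracket_le_two_rpow_mul {n : ℕ} {q : ℝ} (hq : 0 ≤ q) {x y : E n}
    (h : 1 + ‖x‖ ^ 2 ≤ 4 * (1 + ‖y‖ ^ 2)) : bracket q y ≤ 2 ^ q * bracket q x := by
  unfold bracket
  have e : (2 : ℝ) ^ q = (4 : ℝ)⁻¹ ^ (-q / 2) := by
    rw [show (4 : ℝ)⁻¹ = 2 ^ (-2 : ℝ) by norm_num [Real.rpow_neg], ← Real.rpow_mul (by norm_num)]
    congr 1; ring
  rw [e, ← Real.mul_rpow (by norm_num) (by positivity)]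
  exact Real.rpow_le_rpow_of_nonpos (by positivity) (by linarith) (by linarith)

/-- The longer of `y` and `z` has norm at least `‖x‖ / 2`, so its bracket is at most `2 ^ q *
bracket q x`. This is the pointwise inequality behind the stability of such weights under
convolution. -/
theorem bracket_mul_le {n : ℕ} {q : ℝ} (hq : 0 ≤ q) {x y z : E n} (h : ‖x‖ ≤ ‖y‖ + ‖z‖) :
    bracket q y * bracket q z ≤ 2 ^ q * bracket q x * (bracket q y + bracket q z) := by
  have hy := bracket_pos q y
  have hz := bracket_pos q z
  have hx := bracket_pos q x
  have h2 : (0 : ℝ) < 2 ^ q := by positivity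
  have hsq : ‖x‖ ^ 2 ≤ 2 * ‖y‖ ^ 2 + 2 * ‖z‖ ^ 2 := by
    have := pow_le_pow_left₀ (norm_nonneg x) h 2
    nlinarith [sq_nonneg (‖y‖ - ‖z‖)]
  rcases le_total ‖y‖ ‖z‖ with hyz | hyz
  · have : bracket q z ≤ 2 ^ q * bracket q x := bracket_le_two_rpow_mul hq (by
      nlinarith [pow_le_pow_left₀ (norm_nonneg _) hyz 2])
    calc _ ≤ bracket q y * (2 ^ q * bracket q x) := by gcongr
      _ = 2 ^ q * bracket q x * (bracket q y + 0) := by ring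
      _ ≤ _ := by gcongr
  · have : bracket q y ≤ 2 ^ q * bracket q x := bracket_le_two_rpow_mul hq (by
      nlinarith [pow_le_pow_left₀ (norm_nonneg _) hyz 2])
    calc _ ≤ (2 ^ q * bracket q x) * bracket q z := by gcongr
      _ = 2 ^ q * bracket q x * (0 + bracket q z) := by ring
      _ ≤ _ := by gcongr

/-- For `‖h‖ ≤ 1` the second derivative is controlled on the unit ball around `x`, where brackets
are comparable. For `‖h‖ ≥ 1` the kernel is itself bounded by a bracket in `h`, and `bracket_mul_le`
extracts the factor `bracket q x`. The decay exponent has to equal the kernel exponent here. What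
remains in `h` has an integral independent of `x`. -/
theorem abs_secondDiff_bracket_div_le {n : ℕ} {q : ℝ} (hq : 0 ≤ q) (x h : E n) :
    |secondDiff (bracket q) x h| / ‖h‖ ^ q ≤ bracket q x *
      ((2 * (q * (q + 3)) * 2 ^ q + 2) * (min (‖h‖ ^ 2) 1 / ‖h‖ ^ q)
        + 2 ^ q * 2 ^ q * (2 * bracket q h + bracket q (x + h) + bracket q (x - h))) := by
  have hx := bracket_pos q x
  have hh := bracket_pos q h
  have hp := bracket_pos q (x + h)
  have hm := bracket_pos q (x - h)
  have h2 : (0 : ℝ) < 2 ^ q := by positivity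
  rcases le_total ‖h‖ 1 with h1 | h1
  · have hb : |secondDiff (bracket q) x h|
        ≤ 2 * ((q * (q + 3)) * (2 ^ q * bracket q x)) * ‖h‖ ^ 2 := by
      refine abs_secondDiff_le (bracket_contDiff q) fun y hy => ?_
      refine (norm_fderiv_fderiv_bracket_le hq y).trans ?_
      gcongr
      refine bracket_le_two_rpow_mul hq ?_
      rw [mem_closedBall_iff_norm] at hy
      have : ‖x‖ ≤ ‖y‖ + 1 := by
        have := norm_sub_norm_le x y
        rw [norm_sub_rev] at this
        linarith
      nlinarith [pow_le_pow_left₀ (norm_nonneg _) this 2, sq_nonneg (‖y‖ - 1)]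
    have hmin : min (‖h‖ ^ 2) 1 = ‖h‖ ^ 2 := min_eq_left (pow_le_one₀ (norm_nonneg h) h1)
    rw [hmin]
    calc _ ≤ (2 * ((q * (q + 3)) * (2 ^ q * bracket q x)) * ‖h‖ ^ 2) / ‖h‖ ^ q := by gcongr
      _ = bracket q x * ((2 * (q * (q + 3)) * 2 ^ q + 0) * (‖h‖ ^ 2 / ‖h‖ ^ q) + 0) := by ring
      _ ≤ _ := by gcongr <;> positivity
  · have hmin : min (‖h‖ ^ 2) 1 = 1 := min_eq_right (one_le_pow₀ h1)
    -- Since `‖h‖ ≥ 1`, `(1 + ‖h‖²) / 4 ≤ ‖h‖²`; the factor `4⁻¹` becomes `2 ^ q` after the power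
    -- `-q/2`.
    have hk : 1 / ‖h‖ ^ q ≤ 2 ^ q * bracket q h := by
      have e : 1 / ‖h‖ ^ q = (‖h‖ ^ 2) ^ (-q / 2) := by
        rw [← Real.rpow_natCast, ← Real.rpow_mul (norm_nonneg h), one_div,
          ← Real.rpow_neg (norm_nonneg h)]
        congr 1; push_cast; ring
      have e2 : (2 : ℝ) ^ q = (4 : ℝ)⁻¹ ^ (-q / 2) := by
        rw [show (4 : ℝ)⁻¹ = 2 ^ (-2 : ℝ) by norm_num [Real.rpow_neg],
          ← Real.rpow_mul (by norm_num)]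
        congr 1; ring
      unfold bracket
      rw [e, e2, ← Real.mul_rpow (by norm_num) (by positivity)]
      exact Real.rpow_le_rpow_of_nonpos (by positivity) (by nlinarith [one_le_pow₀ h1 (n := 2)])
        (by linarith)
    have hs : |secondDiff (bracket q) x h|
        ≤ 2 * bracket q x + bracket q (x + h) + bracket q (x - h) := by
      unfold secondDiff
      rw [abs_le]; constructor <;> linarith
    have m1 := bracket_mul_le hq (x := x) (y := h) (z := x + h) (by
      simpa [add_comm] using norm_sub_le (x + h) h)
    have m2 := bracket_mul_le hq (x := x) (y := h) (z := x - h) (by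
      simpa [add_comm] using norm_add_le (x - h) h)
    rw [hmin]
    have hpos : 0 ≤ 1 / ‖h‖ ^ q := by positivity
    have p1 : (bracket q (x + h) + bracket q (x - h)) * (1 / ‖h‖ ^ q) ≤
        bracket q x * (2 ^ q * 2 ^ q *
          (2 * bracket q h + bracket q (x + h) + bracket q (x - h))) := by
      calc _ ≤ (bracket q (x + h) + bracket q (x - h)) * (2 ^ q * bracket q h) := by gcongr
        _ = 2 ^ q * (bracket q h * bracket q (x + h) + bracket q h * bracket q (x - h)) := by ring
        _ ≤ 2 ^ q * (2 ^ q * bracket q x * (bracket q h + bracket q (x + h))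
            + 2 ^ q * bracket q x * (bracket q h + bracket q (x - h))) := by gcongr
        _ = _ := by ring
    calc _ ≤ (2 * bracket q x + bracket q (x + h) + bracket q (x - h)) / ‖h‖ ^ q := by gcongr
      _ = bracket q x * ((0 + 2) * (1 / ‖h‖ ^ q))
          + (bracket q (x + h) + bracket q (x - h)) * (1 / ‖h‖ ^ q) := by ring
      _ ≤ bracket q x * ((2 * (q * (q + 3)) * 2 ^ q + 2) * (1 / ‖h‖ ^ q)) + _ := by
          gcongr
          positivity
      _ ≤ _ := (add_le_add le_rfl p1).trans_eq (by ring)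

theorem abs_symmFracLap_bracket_le {n : ℕ} (hn : 1 ≤ n) {s : ℝ} (hs₀ : 0 < s) (hs₁ : s < 1) :
    ∃ C : ℝ, ∀ x : E n, |symmFracLap s (bracket ((n : ℝ) + 2 * s)) x|
      ≤ C * bracket ((n : ℝ) + 2 * s) x := by
  set q : ℝ := (n : ℝ) + 2 * s with hq
  have hq0 : 0 ≤ q := by positivity
  have hψ : Integrable (bracket q : E n → ℝ) := bracket_integrable (by linarith)
  have hk := integrable_min_sq_div_norm_rpow hn hs₀ hs₁
  rw [← hq] at hk
  -- The `4` counts twice the bracket in `h` and its two translates, all having the same integral.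
  refine ⟨|fracConst n s / 2| * ((2 * (q * (q + 3)) * 2 ^ q + 2) *
    (∫ h : E n, min (‖h‖ ^ 2) 1 / ‖h‖ ^ q)
      + 2 ^ q * 2 ^ q * (4 * ∫ h : E n, bracket q h)), fun x => ?_⟩
  have i1 : Integrable fun h => bracket q (x + h) := hψ.comp_add_left x
  have i2 : Integrable fun h => bracket q (x - h) := hψ.comp_sub_left x
  have i3 : Integrable fun h => 2 * bracket q h + bracket q (x + h) :=
    (hψ.const_mul 2).add i1
  have i4 : Integrable fun h => 2 * bracket q h + bracket q (x + h) + bracket q (x - h) :=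
    i3.add i2
  have i5 := hk.const_mul (2 * (q * (q + 3)) * 2 ^ q + 2)
  have i6 := i4.const_mul (2 ^ q * 2 ^ q)
  have hb := norm_integral_le_of_norm_le ((i5.add i6).const_mul (bracket q x))
    (f := fun h => secondDiff (bracket q) x h / ‖h‖ ^ q) (Eventually.of_forall fun h => by
      rw [Real.norm_eq_abs, abs_div, abs_of_nonneg (Real.rpow_nonneg (norm_nonneg h) _)]
      exact abs_secondDiff_bracket_div_le hq0 x h)
  have he : ∫ h, bracket q x * ((fun h : E n => (2 * (q * (q + 3)) * 2 ^ q + 2) *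
      (min (‖h‖ ^ 2) 1 / ‖h‖ ^ q) : E n → ℝ) + (fun h => 2 ^ q * 2 ^ q *
        (2 * bracket q h + bracket q (x + h) + bracket q (x - h)) : E n → ℝ) : E n → ℝ) h
      = bracket q x * ((2 * (q * (q + 3)) * 2 ^ q + 2) *
        (∫ h : E n, min (‖h‖ ^ 2) 1 / ‖h‖ ^ q)
          + 2 ^ q * 2 ^ q * (4 * ∫ h : E n, bracket q h)) := by
    rw [integral_const_mul, integral_add' i5 i6, integral_const_mul, integral_const_mul,
      integral_add i3 i2, integral_add (hψ.const_mul 2) i1, integral_const_mul,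
      integral_add_left_eq_self (fun h => bracket q h) x,
      integral_sub_left_eq_self (fun h => bracket q h) volume x]
    ring
  rw [he] at hb
  unfold symmFracLap
  rw [abs_mul, mul_assoc, ← Real.norm_eq_abs (∫ _, _)]
  gcongr
  rw [mul_comm _ (bracket q x)]
  exact hb

/-- Positive integrable functions whose derivatives up to order two and whose fractional
Laplacian are dominated by the function itself. -/
structure IsProfile {n : ℕ} (s C : ℝ) (ψ : E n → ℝ) : Prop where
  contDiff : ContDiff ℝ 2 ψ
  pos : ∀ x, 0 < ψ x
  le_one : ∀ x, ψ x ≤ 1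
  apply_zero : ψ 0 = 1
  integrable : Integrable ψ
  fderiv_le : ∀ x, ‖fderiv ℝ ψ x‖ ≤ C * ψ x
  fderiv_fderiv_le : ∀ x, ‖fderiv ℝ (fderiv ℝ ψ) x‖ ≤ C * ψ x
  symmFracLap_le : ∀ x, |symmFracLap s ψ x| ≤ C * ψ x

theorem exists_isProfile {n : ℕ} (hn : 1 ≤ n) {s : ℝ} (hs₀ : 0 < s) (hs₁ : s < 1) :
    ∃ (C : ℝ) (ψ : E n → ℝ), IsProfile s C ψ := by
  obtain ⟨C, hC⟩ := abs_symmFracLap_bracket_le hn hs₀ hs₁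
  set q : ℝ := (n : ℝ) + 2 * s with hq
  have hq0 : 0 ≤ q := by positivity
  refine ⟨max C (q * (q + 3)), bracket q, bracket_contDiff q, bracket_pos q, bracket_le_one hq0,
    by simp [bracket], bracket_integrable (by linarith), fun x => ?_, fun x => ?_, fun x => ?_⟩
  · refine (norm_fderiv_bracket_le hq0 x).trans ?_
    have := bracket_pos q x
    gcongr
    exact le_max_of_le_right (by nlinarith)
  · refine (norm_fderiv_fderiv_bracket_le hq0 x).trans ?_
    have := bracket_pos q x
    gcongr
    exact le_max_right _ _
  · refine (hC x).trans ?_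
    have := bracket_pos q x
    gcongr
    exact le_max_left _ _

/-! ### Weak derivatives in `L²` and rescaled profiles. -/

theorem weakPartial_eq {n : ℕ} {i : Fin n} {v w : L2 n} (h : IsWeakPartial i v w) :
    weakPartial i v = w := by
  have hex : ∃ w, IsWeakPartial i v w := ⟨w, h⟩
  rw [weakPartial, dif_pos hex]
  exact hex.choose_spec.unique h

theorem fracLap_eq {n : ℕ} {s : ℝ} {v w : L2 n} (h : IsFracLap s v w) : fracLap s v = w := by
  have hex : ∃ w, IsFracLap s v w := ⟨w, h⟩
  rw [fracLap, dif_pos hex]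
  exact hex.choose_spec.unique h

theorem IsWeakPartial.const_smul {n : ℕ} {i : Fin n} {v w : L2 n} (h : IsWeakPartial i v w)
    (c : ℝ) : IsWeakPartial i (c • v) (c • w) := by
  intro η hη hc
  have e1 : ∫ x, (c • v : L2 n) x * fderiv ℝ η x (EuclideanSpace.single i 1)
      = c * ∫ x, v x * fderiv ℝ η x (EuclideanSpace.single i 1) := by
    rw [← integral_const_mul]
    refine integral_congr_ae ?_
    filter_upwards [Lp.coeFn_smul c v] with x hx
    rw [hx, Pi.smul_apply, smul_eq_mul, mul_assoc]
  have e2 : ∫ x, (c • w : L2 n) x * η x = c * ∫ x, w x * η x := by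
    rw [← integral_const_mul]
    refine integral_congr_ae ?_
    filter_upwards [Lp.coeFn_smul c w] with x hx
    rw [hx, Pi.smul_apply, smul_eq_mul, mul_assoc]
  rw [e1, e2, h η hη hc, mul_neg]

theorem IsFracLap.const_smul {n : ℕ} {s : ℝ} {v w : L2 n} (h : IsFracLap s v w)
    (c : ℝ) : IsFracLap s (c • v) (c • w) := by
  intro η
  have e1 : ∫ x, (c • v : L2 n) x * fracLapPV s η x = c * ∫ x, v x * fracLapPV s η x := by
    rw [← integral_const_mul]
    refine integral_congr_ae ?_
    filter_upwards [Lp.coeFn_smul c v] with x hx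
    rw [hx, Pi.smul_apply, smul_eq_mul, mul_assoc]
  have e2 : ∫ x, (c • w : L2 n) x * η x = c * ∫ x, w x * η x := by
    rw [← integral_const_mul]
    refine integral_congr_ae ?_
    filter_upwards [Lp.coeFn_smul c w] with x hx
    rw [hx, Pi.smul_apply, smul_eq_mul, mul_assoc]
  rw [e1, e2, h η]

theorem MemH1.weakPartial_smul {n : ℕ} {v : L2 n} (h : MemH1 v) (i : Fin n) (c : ℝ) :
    weakPartial i (c • v) = c • weakPartial i v := by
  obtain ⟨w, hw⟩ := h i
  rw [weakPartial_eq hw, weakPartial_eq (hw.const_smul c)]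

theorem MemH1.const_smul {n : ℕ} {v : L2 n} (h : MemH1 v) (c : ℝ) : MemH1 (c • v) := fun i => by
  obtain ⟨w, hw⟩ := h i
  exact ⟨_, hw.const_smul c⟩

theorem MemH2.const_smul {n : ℕ} {v : L2 n} (h : MemH2 v) (c : ℝ) : MemH2 (c • v) :=
  ⟨h.1.const_smul c, fun i => by rw [h.1.weakPartial_smul]; exact (h.2 i).const_smul c⟩

theorem MemH2.lapl_smul {n : ℕ} {v : L2 n} (h : MemH2 v) (c : ℝ) :
    lapl (c • v) = c • lapl v := by
  unfold lapl
  rw [Finset.smul_sum]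
  refine Finset.sum_congr rfl fun i _ => ?_
  rw [h.1.weakPartial_smul, (h.2 i).weakPartial_smul]

theorem isWeakPartial_of_ae_eq {n : ℕ} {i : Fin n} {f : E n → ℝ} (hf : ContDiff ℝ 1 f)
    {v w : L2 n} (hv : v =ᵐ[volume] f)
    (hw : w =ᵐ[volume] fun x => fderiv ℝ f x (EuclideanSpace.single i 1)) :
    IsWeakPartial i v w := by
  intro η hη hc
  set e : E n := EuclideanSpace.single i 1
  have cf' : Continuous fun x => fderiv ℝ f x e :=
    (hf.continuous_fderiv (by norm_num)).clm_apply continuous_const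
  have cη' : Continuous fun x => fderiv ℝ η x e :=
    (hη.continuous_fderiv (by norm_num)).clm_apply continuous_const
  have e1 : ∫ x, v x * fderiv ℝ η x e = ∫ x, f x * fderiv ℝ η x e := by
    refine integral_congr_ae ?_
    filter_upwards [hv] with x hx
    rw [hx]
  have e2 : ∫ x, w x * η x = ∫ x, fderiv ℝ f x e * η x := by
    refine integral_congr_ae ?_
    filter_upwards [hw] with x hx
    rw [hx]
  rw [e1, e2]
  refine integral_mul_fderiv_eq_neg_fderiv_mul_of_integrable ?_ ?_ ?_
    (fun x _ => hf.differentiable (by norm_num) x) (fun x _ => hη.differentiable (by norm_num) x)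
  · exact (cf'.mul hη.continuous).integrable_of_hasCompactSupport hc.mul_left
  · exact (hf.continuous.mul cη').integrable_of_hasCompactSupport (hc.fderiv_apply ℝ e).mul_left
  · exact (hf.continuous.mul hη.continuous).integrable_of_hasCompactSupport hc.mul_left

theorem memLp_two_of_abs_le {n : ℕ} {f g : E n → ℝ} (hf : AEStronglyMeasurable f volume)
    (hg : Integrable g) (hg0 : ∀ x, 0 ≤ g x) (hg1 : ∀ x, g x ≤ 1) {C : ℝ}
    (h : ∀ x, |f x| ≤ C * g x) : MemLp f 2 volume := by
  have hg2 : MemLp g 2 volume := by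
    rw [memLp_two_iff_integrable_sq hg.aestronglyMeasurable]
    refine hg.mono' (hg.aestronglyMeasurable.pow 2) (Eventually.of_forall fun x => ?_)
    rw [Real.norm_of_nonneg (sq_nonneg _)]
    nlinarith [hg0 x, hg1 x]
  exact (hg2.const_mul C).mono' hf (Eventually.of_forall h)

/-- Homogeneity: substituting `k = r • h`, the kernel gives `r ^ (n + 2s)` and the Jacobian `r ^
(-n)`. -/
theorem symmFracLap_comp_smul {n : ℕ} (s : ℝ) (f : E n → ℝ) {r : ℝ} (hr : 0 < r) (x : E n) :
    symmFracLap s (fun y => f (r • y)) x = r ^ (2 * s) * symmFracLap s f (r • x) := by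
  unfold symmFracLap
  have h1 : ∀ h : E n, secondDiff (fun y => f (r • y)) x h / ‖h‖ ^ ((n : ℝ) + 2 * s)
      = r ^ ((n : ℝ) + 2 * s) * ((fun k => secondDiff f (r • x) k / ‖k‖ ^ ((n : ℝ) + 2 * s))
        (r • h)) := by
    intro h
    have : 0 < r ^ ((n : ℝ) + 2 * s) := by positivity
    simp only [norm_smul, Real.norm_of_nonneg hr.le, secondDiff, smul_add, smul_sub]
    rw [Real.mul_rpow hr.le (norm_nonneg h)]
    field_simp
  have e := Measure.integral_comp_smul volume
    (fun k : E n => secondDiff f (r • x) k / ‖k‖ ^ ((n : ℝ) + 2 * s)) r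
  simp_rw [h1]
  rw [integral_const_mul, e, finrank_euclideanSpace_fin,
    abs_of_pos (by positivity), Real.rpow_add hr, Real.rpow_natCast, smul_eq_mul]
  have : 0 < r ^ n := by positivity
  field_simp

theorem symmFracLap_stronglyMeasurable {n : ℕ} (s : ℝ) {f : E n → ℝ} (hf : Continuous f) :
    StronglyMeasurable (symmFracLap s f) := by
  unfold symmFracLap
  refine StronglyMeasurable.const_mul ?_ _
  refine StronglyMeasurable.integral_prod_right
    (f := fun x h => secondDiff f x h / ‖h‖ ^ ((n : ℝ) + 2 * s)) ?_
  exact ((secondDiff_continuous hf).measurable.div (by fun_prop)).stronglyMeasurable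

theorem abs_coeFn_sum_le {n : ℕ} {ι : Type*} (S : Finset ι) (f : ι → L2 n) {g : E n → ℝ}
    (h : ∀ i, ∀ᵐ x, |f i x| ≤ g x) : ∀ᵐ x, |(∑ i ∈ S, f i : L2 n) x| ≤ S.card * g x := by
  classical
  induction S using Finset.induction_on with
  | empty =>
    filter_upwards [Lp.coeFn_zero ℝ 2 (volume : Measure (E n))] with x hx
    rw [Finset.sum_empty, hx]
    simp
  | insert a S ha ih =>
    rw [Finset.sum_insert ha, Finset.card_insert_of_notMem ha]
    filter_upwards [Lp.coeFn_add (f a) (∑ i ∈ S, f i), ih, h a] with x h1 h2 h3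
    rw [h1, Pi.add_apply]
    refine (abs_add_le _ _).trans ?_
    rw [Nat.cast_succ]
    linarith

theorem norm_single_one {n : ℕ} (i : Fin n) : ‖(EuclideanSpace.single i 1 : E n)‖ = 1 := by
  simp

/-- Rescaled profiles as elements of `L²`. -/
theorem IsProfile.exists_scaled {n : ℕ} (hn : 1 ≤ n) {s C : ℝ} (hs₀ : 0 < s) (hs₁ : s < 1)
    {ψ : E n → ℝ} (hψ : IsProfile s C ψ) {r : ℝ} (hr : 0 < r) :
    ∃ Ψ W : L2 n, Ψ =ᵐ[volume] (fun x => ψ (r • x)) ∧ MemH2 Ψ ∧ IsFracLap s Ψ W ∧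
      (∀ᵐ x, |W x| ≤ C * r ^ (2 * s) * ψ (r • x)) ∧
      ∀ᵐ x, |lapl Ψ x| ≤ n * (C * r ^ 2 * ψ (r • x)) := by
  have hC : 0 ≤ C := by
    have h1 := hψ.fderiv_le 0
    rw [hψ.apply_zero, mul_one] at h1
    exact (norm_nonneg _).trans h1
  set f : E n → ℝ := fun x => ψ (r • x) with hf
  have hfc : ContDiff ℝ 2 f := hψ.contDiff.comp (contDiff_const_smul r)
  have hfi : Integrable f := hψ.integrable.comp_smul hr.ne'
  have hf0 : ∀ x, 0 ≤ f x := fun x => (hψ.pos _).le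
  have hf1 : ∀ x, f x ≤ 1 := fun x => hψ.le_one _
  have hDf : fderiv ℝ f = fun x => r • fderiv ℝ ψ (r • x) := by
    ext1 x
    exact fderiv_comp_smul (f := ψ) r
  have hψ' : ContDiff ℝ 1 (fderiv ℝ ψ) := hψ.contDiff.fderiv_right (by norm_num)
  have hD1 : ∀ x, ‖fderiv ℝ f x‖ ≤ C * r * f x := by
    intro x
    rw [hDf]
    simp only [norm_smul, Real.norm_of_nonneg hr.le]
    calc r * ‖fderiv ℝ ψ (r • x)‖ ≤ r * (C * ψ (r • x)) := by gcongr; exact hψ.fderiv_le _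
      _ = _ := by rw [hf]; ring
  have hDDf : ∀ x, fderiv ℝ (fderiv ℝ f) x = r • r • fderiv ℝ (fderiv ℝ ψ) (r • x) := by
    intro x
    have h := ((hψ'.differentiable (by norm_num) (r • x)).hasFDerivAt.comp x
      ((hasFDerivAt_id x).const_smul r)).const_smul r
    rw [hDf]
    refine h.fderiv.trans ?_
    ext y z
    simp
  have hD2 : ∀ x, ‖fderiv ℝ (fderiv ℝ f) x‖ ≤ C * r ^ 2 * f x := by
    intro x
    rw [hDDf]
    refine (ContinuousLinearMap.opNorm_smul_le _ _).trans ?_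
    rw [Real.norm_of_nonneg hr.le]
    have := ContinuousLinearMap.opNorm_smul_le r (fderiv ℝ (fderiv ℝ ψ) (r • x))
    rw [Real.norm_of_nonneg hr.le] at this
    calc _ ≤ r * (r * ‖fderiv ℝ (fderiv ℝ ψ) (r • x)‖) := by gcongr
      _ ≤ r * (r * (C * ψ (r • x))) := by gcongr; exact hψ.fderiv_fderiv_le _
      _ = _ := by rw [hf]; ring
  have hf' : ContDiff ℝ 1 (fderiv ℝ f) := hfc.fderiv_right (by norm_num)
  set f₁ : Fin n → E n → ℝ := fun i x => fderiv ℝ f x (EuclideanSpace.single i 1) with hf₁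
  have hf₁c : ∀ i, ContDiff ℝ 1 (f₁ i) := fun i => hf'.clm_apply contDiff_const
  have hf₁b : ∀ i x, |f₁ i x| ≤ C * r * f x := by
    intro i x
    rw [← Real.norm_eq_abs]
    refine (ContinuousLinearMap.le_opNorm _ _).trans ?_
    rw [norm_single_one, mul_one]
    exact hD1 x
  set f₂ : Fin n → Fin n → E n → ℝ :=
    fun i j x => fderiv ℝ (f₁ i) x (EuclideanSpace.single j 1) with hf₂
  have hf₂b : ∀ i j x, |f₂ i j x| ≤ C * r ^ 2 * f x := by
    intro i j x
    have e : f₂ i j x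
        = fderiv ℝ (fderiv ℝ f) x (EuclideanSpace.single j 1) (EuclideanSpace.single i 1) := by
      have hd := (hf'.differentiable (by norm_num) x).hasFDerivAt.clm_apply
        (hasFDerivAt_const (EuclideanSpace.single i 1 : E n) x)
      simp only [hf₂, hf₁]
      rw [hd.fderiv]
      simp
    rw [e]
    have h1 := ContinuousLinearMap.le_opNorm (fderiv ℝ (fderiv ℝ f) x)
      (EuclideanSpace.single j 1 : E n)
    have h2 := ContinuousLinearMap.le_opNorm
      (fderiv ℝ (fderiv ℝ f) x (EuclideanSpace.single j 1)) (EuclideanSpace.single i 1 : E n)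
    rw [norm_single_one, mul_one] at h1 h2
    exact h2.trans (h1.trans (hD2 x))
  have hf₂c : ∀ i j, Continuous (f₂ i j) := fun i j =>
    ((hf₁c i).continuous_fderiv (by norm_num)).clm_apply continuous_const
  have hw : ∀ x, symmFracLap s f x = r ^ (2 * s) * symmFracLap s ψ (r • x) :=
    symmFracLap_comp_smul s ψ hr
  have hwb : ∀ x, |symmFracLap s f x| ≤ C * r ^ (2 * s) * f x := by
    intro x
    rw [hw, abs_mul, abs_of_pos (by positivity)]
    calc _ ≤ r ^ (2 * s) * (C * ψ (r • x)) := by gcongr; exact hψ.symmFracLap_le _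
      _ = _ := by rw [hf]; ring
  have m0 : MemLp f 2 volume := memLp_two_of_abs_le hfc.continuous.aestronglyMeasurable hfi hf0 hf1
    (C := 1) fun x => by rw [abs_of_nonneg (hf0 x), one_mul]
  have m1 : ∀ i, MemLp (f₁ i) 2 volume := fun i =>
    memLp_two_of_abs_le (hf₁c i).continuous.aestronglyMeasurable hfi hf0 hf1 (hf₁b i)
  have m2 : ∀ i j, MemLp (f₂ i j) 2 volume := fun i j =>
    memLp_two_of_abs_le (hf₂c i j).aestronglyMeasurable hfi hf0 hf1 (hf₂b i j)
  have mw : MemLp (symmFracLap s f) 2 volume := memLp_two_of_abs_le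
    (symmFracLap_stronglyMeasurable s hfc.continuous).aestronglyMeasurable hfi hf0 hf1 hwb
  have p1 : ∀ i, IsWeakPartial i (m0.toLp f) ((m1 i).toLp (f₁ i)) := fun i =>
    isWeakPartial_of_ae_eq (hfc.of_le (by norm_num)) m0.coeFn_toLp (m1 i).coeFn_toLp
  have p2 : ∀ i j, IsWeakPartial j ((m1 i).toLp (f₁ i)) ((m2 i j).toLp (f₂ i j)) := fun i j =>
    isWeakPartial_of_ae_eq (hf₁c i) (m1 i).coeFn_toLp (m2 i j).coeFn_toLp
  refine ⟨m0.toLp f, mw.toLp _, m0.coeFn_toLp, ⟨fun i => ⟨_, p1 i⟩, fun i j => ?_⟩, ?_, ?_, ?_⟩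
  · rw [weakPartial_eq (p1 i)]
    exact ⟨_, p2 i j⟩
  · refine isFracLap_of_ae_eq hn hs₀ hs₁ hfc hfi (M := max 1 (C * r ^ 2)) (fun x => ?_)
      (fun x => ?_) m0.coeFn_toLp mw.coeFn_toLp
    · rw [abs_of_nonneg (hf0 x)]
      exact le_max_of_le_left (hf1 x)
    · refine (hD2 x).trans (le_max_of_le_right ?_)
      exact mul_le_of_le_one_right (by positivity) (hf1 x)
  · filter_upwards [mw.coeFn_toLp] with x hx
    rw [hx]
    exact hwb x
  · have : lapl (m0.toLp f) = ∑ i, (m2 i i).toLp (f₂ i i) := by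
      unfold lapl
      refine Finset.sum_congr rfl fun i _ => ?_
      rw [weakPartial_eq (p1 i), weakPartial_eq (p2 i i)]
    rw [this]
    have := abs_coeFn_sum_le Finset.univ (fun i => (m2 i i).toLp (f₂ i i))
      (g := fun x => C * r ^ 2 * f x) fun i => by
        filter_upwards [(m2 i i).coeFn_toLp] with x hx
        rw [hx]
        exact hf₂b i i x
    simpa using this

/-! ### Separated test functions and time cutoffs. -/

/-- Test functions with separated variables. -/
theorem isTestFunction_smul {n : ℕ} {δ T : ℝ} {Ψ W : L2 n} (hΨ : MemH2 Ψ)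
    (hW : IsFracLap (δ / 2) Ψ W) {η : ℝ → ℝ} (hη : ContDiff ℝ ∞ η) (hT : ∀ t, T < t → η t = 0) :
    IsTestFunction δ T fun t => η t • Ψ where
  memH2 t _ := hΨ.const_smul _
  cont := (hη.continuous.smul continuous_const).continuousOn
  cont_grad i := by
    simp_rw [hΨ.1.weakPartial_smul]
    exact (hη.continuous.smul continuous_const).continuousOn
  cont_hess i j := by
    simp_rw [hΨ.1.weakPartial_smul, (hΨ.2 j).weakPartial_smul]
    exact (hη.continuous.smul continuous_const).continuousOn
  memHfrac t _ := ⟨fun _ => ⟨_, hW.const_smul _⟩, fun _ => hΨ.1.const_smul _⟩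
  contDiff_one := ((contDiff_infty.1 hη _).smul contDiff_const).contDiffOn
  contDiff_frac _ := by
    simp_rw [fun t => fracLap_eq (hW.const_smul (η t))]
    exact ((contDiff_infty.1 hη _).smul contDiff_const).contDiffOn
  contDiff_grad _ i := by
    simp_rw [hΨ.1.weakPartial_smul]
    exact ((contDiff_infty.1 hη _).smul contDiff_const).contDiffOn
  contDiff_two := ((contDiff_infty.1 hη _).smul contDiff_const).contDiffOn
  support t ht := by simp [hT t ht]

/-- Agreement is required only on `[0,∞)`, so that the lemma applies again to `dt φ` and yields the
second derivative. -/
theorem dt_smul {n : ℕ} {Ψ : L2 n} {η : ℝ → ℝ} (hη : Differentiable ℝ η) {φ : ℝ → L2 n}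
    (hφ : ∀ t ∈ Ici (0 : ℝ), φ t = η t • Ψ) {t : ℝ} (ht : t ∈ Ici (0 : ℝ)) :
    dt φ t = deriv η t • Ψ := by
  unfold dt
  rw [derivWithin_congr hφ (hφ t ht)]
  exact ((hη t).hasDerivAt.smul_const Ψ).hasDerivWithinAt.derivWithin (uniqueDiffOn_Ici 0 t ht)

theorem exists_abs_le_of_eq_zero {g : ℝ → ℝ} (hg : Continuous g) {a b : ℝ}
    (h1 : ∀ s < a, g s = 0) (h2 : ∀ s, b < s → g s = 0) : ∃ C, ∀ s, |g s| ≤ C := by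
  have hc : HasCompactSupport g := by
    refine HasCompactSupport.intro (isCompact_Icc (a := a) (b := b)) fun s hs => ?_
    rw [mem_Icc, not_and_or, not_le, not_le] at hs
    exact hs.elim (h1 s) (h2 s)
  exact hg.bounded_above_of_compact_support hc

theorem deriv_eq_zero_of_eventuallyEq_const {g : ℝ → ℝ} {s c : ℝ} (h : g =ᶠ[𝓝 s] fun _ => c) :
    deriv g s = 0 := by
  rw [h.deriv_eq, deriv_const]

/-- Cutoffs in time whose derivatives are dominated by a power of the cutoff. -/
structure IsCutoff (p C : ℝ) (η : ℝ → ℝ) : Prop where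
  const_nonneg : 0 ≤ C
  contDiff : ContDiff ℝ ∞ η
  nonneg : ∀ s, 0 ≤ η s
  le_one : ∀ s, η s ≤ 1
  eq_one : ∀ s ≤ 1 / 2, η s = 1
  eq_zero : ∀ s, 1 ≤ s → η s = 0
  deriv_eq_zero : ∀ s < 1 / 2, deriv η s = 0
  deriv_deriv_eq_zero : ∀ s < 1 / 2, deriv (deriv η) s = 0
  deriv_le : ∀ s, |deriv η s| ≤ C * η s ^ (1 / p)
  deriv_deriv_le : ∀ s, |deriv (deriv η) s| ≤ C * η s ^ (1 / p)

theorem exists_isCutoff {p : ℝ} (hp : 1 < p) : ∃ (C : ℝ) (η : ℝ → ℝ), IsCutoff p C η := by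
  -- The cutoff will be `χ ^ (k + 2)`. Two derivatives cost two powers, so the bound needs `k ≥ (k +
  -- 2) / p`, that is, `k (p - 1) ≥ 2`.
  obtain ⟨k, hk⟩ := exists_nat_ge (2 / (p - 1))
  have hp1 : 0 < p - 1 := by linarith
  rw [div_le_iff₀ hp1] at hk
  set χ : ℝ → ℝ := fun s => Real.smoothTransition (2 - 2 * s) with hχ
  have hχc : ContDiff ℝ ∞ χ := Real.smoothTransition.contDiff.comp (by fun_prop)
  have hχ0 : ∀ s, 0 ≤ χ s := fun s => Real.smoothTransition.nonneg _
  have hχ1 : ∀ s, χ s ≤ 1 := fun s => Real.smoothTransition.le_one _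
  have hone : ∀ s ≤ 1 / 2, χ s = 1 := fun s hs =>
    Real.smoothTransition.one_of_one_le (by linarith)
  have hzero : ∀ s, 1 ≤ s → χ s = 0 := fun s hs =>
    Real.smoothTransition.zero_of_nonpos (by linarith)
  have hχ'c : ContDiff ℝ ∞ (deriv χ) := (contDiff_infty_iff_deriv.1 hχc).2
  have hd : ∀ s, HasDerivAt χ (deriv χ s) s := fun s =>
    (hχc.differentiable (by norm_num) s).hasDerivAt
  have hdd : ∀ s, HasDerivAt (deriv χ) (deriv (deriv χ) s) s := fun s =>
    (hχ'c.differentiable (by norm_num) s).hasDerivAt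
  have d1 : ∀ s < 1 / 2, deriv χ s = 0 := fun s hs =>
    deriv_eq_zero_of_eventuallyEq_const (c := 1) (by
      filter_upwards [Iio_mem_nhds hs] with y hy using hone y (le_of_lt hy))
  have d2 : ∀ s, 1 < s → deriv χ s = 0 := fun s hs =>
    deriv_eq_zero_of_eventuallyEq_const (c := 0) (by
      filter_upwards [Ioi_mem_nhds hs] with y hy using hzero y (le_of_lt hy))
  have dd1 : ∀ s < 1 / 2, deriv (deriv χ) s = 0 := fun s hs =>
    deriv_eq_zero_of_eventuallyEq_const (c := 0) (by
      filter_upwards [Iio_mem_nhds hs] with y hy using d1 y hy)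
  have dd2 : ∀ s, 1 < s → deriv (deriv χ) s = 0 := fun s hs =>
    deriv_eq_zero_of_eventuallyEq_const (c := 0) (by
      filter_upwards [Ioi_mem_nhds hs] with y hy using d2 y hy)
  obtain ⟨A, hA⟩ := exists_abs_le_of_eq_zero hχ'c.continuous d1 d2
  obtain ⟨B, hB⟩ := exists_abs_le_of_eq_zero
    ((contDiff_infty_iff_deriv.1 hχ'c).2).continuous dd1 dd2
  have hA0 : 0 ≤ A := (abs_nonneg _).trans (hA 0)
  have hB0 : 0 ≤ B := (abs_nonneg _).trans (hB 0)
  have hη' : deriv (fun s => χ s ^ (k + 2)) = fun s => (k + 2) * χ s ^ (k + 1) * deriv χ s := by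
    ext s
    rw [((hd s).fun_pow (k + 2)).deriv]
    push_cast
    simp
  have hη'' : deriv (deriv (fun s => χ s ^ (k + 2))) = fun s =>
      (k + 2) * ((k + 1) * χ s ^ k * deriv χ s) * deriv χ s
        + (k + 2) * χ s ^ (k + 1) * deriv (deriv χ) s := by
    rw [hη']
    ext s
    rw [((((hd s).fun_pow (k + 1)).const_mul ((k : ℝ) + 2)).fun_mul (hdd s)).deriv]
    push_cast
    simp
  have hpow : ∀ s, χ s ^ k ≤ (χ s ^ (k + 2)) ^ (1 / p) := by
    intro s
    rw [← Real.rpow_natCast, ← Real.rpow_natCast, ← Real.rpow_mul (hχ0 s)]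
    refine Real.rpow_le_rpow_of_exponent_ge' (hχ0 s) (hχ1 s) (by positivity) ?_
    push_cast
    rw [mul_one_div, div_le_iff₀ (by linarith)]
    linarith
  have hpow' : ∀ s, χ s ^ (k + 1) ≤ (χ s ^ (k + 2)) ^ (1 / p) := fun s =>
    (pow_le_pow_of_le_one (hχ0 s) (hχ1 s) (Nat.le_succ k)).trans (hpow s)
  refine ⟨(k + 2) * A + (k + 2) * ((k + 1) * A) * A + (k + 2) * B, fun s => χ s ^ (k + 2),
    by positivity, hχc.pow _, fun s => pow_nonneg (hχ0 s) _, fun s => pow_le_one₀ (hχ0 s) (hχ1 s),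
    fun s hs => by simp [hone s hs], fun s hs => by simp [hzero s hs], fun s hs => ?_,
    fun s hs => ?_, fun s => ?_, fun s => ?_⟩
  · rw [hη']; simp [d1 s hs]
  · rw [hη'']; simp [d1 s hs, dd1 s hs]
  · rw [hη']
    simp only
    have h0 := pow_nonneg (hχ0 s) (k + 1)
    have h2 := Real.rpow_nonneg (pow_nonneg (hχ0 s) (k + 2)) (1 / p)
    rw [abs_mul, abs_of_nonneg (by positivity)]
    calc _ ≤ (k + 2) * (χ s ^ (k + 2)) ^ (1 / p) * A := by
          gcongr
          · exact hpow' s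
          · exact hA s
      _ = ((k + 2) * A + 0 + 0) * (χ s ^ (k + 2)) ^ (1 / p) := by ring
      _ ≤ _ := by
          gcongr <;> positivity
  · rw [hη'']
    simp only
    have h0 := pow_nonneg (hχ0 s) (k + 1)
    have h1 := pow_nonneg (hχ0 s) k
    have h2 := Real.rpow_nonneg (pow_nonneg (hχ0 s) (k + 2)) (1 / p)
    refine (abs_add_le _ _).trans ?_
    simp only [abs_mul, abs_of_nonneg h0, abs_of_nonneg h1]
    rw [abs_of_nonneg (by positivity : (0 : ℝ) ≤ k + 2),
      abs_of_nonneg (by positivity : (0 : ℝ) ≤ k + 1)]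
    calc _ ≤ (k + 2) * ((k + 1) * (χ s ^ (k + 2)) ^ (1 / p) * A) * A
          + (k + 2) * (χ s ^ (k + 2)) ^ (1 / p) * B := by
          gcongr
          · exact hpow s
          · exact hA s
          · exact hA s
          · exact hpow' s
          · exact hB s
      _ = (0 + (k + 2) * ((k + 1) * A) * A + (k + 2) * B) * (χ s ^ (k + 2)) ^ (1 / p) := by ring
      _ ≤ _ := by gcongr; positivity

/-! ### The weak formulation for separated test functions. -/

/-- Cauchy–Schwarz in `x`, then integration in `t`. It makes Fubini available for both `|u|` and
`|u|^p`, the latter because the `L²` norm of `|u|^p` is the `p`-th power of the `L^{2p}` norm of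
`u`. -/
theorem integrable_prod_mul_of_lintegral_eLpNorm_two_lt_top {n : ℕ} {μ : Measure ℝ} [SFinite μ]
    {v : ℝ → E n → ℝ} (hv : AEStronglyMeasurable (Function.uncurry v) (μ.prod volume))
    (hfin : ∫⁻ t, eLpNorm (v t) 2 volume ∂μ < ⊤) (Ψ : L2 n) :
    Integrable (fun z : ℝ × E n => v z.1 z.2 * Ψ z.2) (μ.prod volume) := by
  have hm : AEStronglyMeasurable (fun z : ℝ × E n => v z.1 z.2 * Ψ z.2) (μ.prod volume) :=
    hv.mul ((Lp.aestronglyMeasurable Ψ).comp_snd)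
  refine ⟨hm, ?_⟩
  rw [hasFiniteIntegral_iff_enorm, lintegral_prod _ hm.enorm]
  have hb : ∀ᵐ t ∂μ, ∫⁻ x, ‖v t x * Ψ x‖ₑ ≤ eLpNorm (v t) 2 volume * eLpNorm Ψ 2 volume := by
    filter_upwards [hv.prodMk_left] with t ht
    rw [← eLpNorm_one_eq_lintegral_enorm]
    have h := eLpNorm_smul_le_mul_eLpNorm (p := 2) (q := 2) (r := 1) (f := (Ψ : E n → ℝ))
      (φ := v t) (Lp.aestronglyMeasurable Ψ) ht
    exact h
  refine (lintegral_mono_ae hb).trans_lt ?_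
  rw [lintegral_mul_const' _ _ (Lp.eLpNorm_ne_top Ψ)]
  exact ENNReal.mul_lt_top hfin (Lp.eLpNorm_lt_top Ψ)

theorem IsWeakSolution.integrable_abs_mul {n : ℕ} {β σ p T : ℝ} {u₀ u₁ : L2 n}
    {u : ℝ → E n → ℝ} (hu : IsWeakSolution β σ p u₀ u₁ T u) (Ψ : L2 n) :
    Integrable (fun z : ℝ × E n => |u z.1 z.2| * Ψ z.2)
      ((volume.restrict (Ioo 0 T)).prod volume) := by
  refine integrable_prod_mul_of_lintegral_eLpNorm_two_lt_top
    (v := fun t x => |u t x|) hu.meas.norm ?_ Ψ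
  refine lt_of_eq_of_lt (lintegral_congr fun t => ?_) hu.memL1L2
  exact eLpNorm_norm (u t)

theorem IsWeakSolution.integrable_abs_rpow_mul {n : ℕ} {β σ p T : ℝ} (hp : 0 < p) {u₀ u₁ : L2 n}
    {u : ℝ → E n → ℝ} (hu : IsWeakSolution β σ p u₀ u₁ T u) (Ψ : L2 n) :
    Integrable (fun z : ℝ × E n => |u z.1 z.2| ^ p * Ψ z.2)
      ((volume.restrict (Ioo 0 T)).prod volume) := by
  refine integrable_prod_mul_of_lintegral_eLpNorm_two_lt_top
    (v := fun t x => |u t x| ^ p) ?_ ?_ Ψ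
  · exact (hu.meas.norm.aemeasurable.pow_const p).aestronglyMeasurable
  refine lt_of_eq_of_lt (lintegral_congr fun t => ?_) hu.memLpL2p
  have := eLpNorm_norm_rpow (p := 2) (μ := volume) (u t) hp
  rw [ENNReal.ofReal_mul zero_le_two, ENNReal.ofReal_ofNat]
  exact this

theorem abs_integral_mul_le {n : ℕ} {v F ψ : E n → ℝ} {c : ℝ}
    (hv : Integrable fun x => |v x| * ψ x) (hF : ∀ᵐ x, |F x| ≤ c * ψ x) :
    |∫ x, v x * F x| ≤ c * ∫ x, |v x| * ψ x := by
  rw [← integral_const_mul, ← Real.norm_eq_abs]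
  refine norm_integral_le_of_norm_le (hv.const_mul c) ?_
  filter_upwards [hF] with x hx
  rw [Real.norm_eq_abs, abs_mul]
  calc |v x| * |F x| ≤ |v x| * (c * ψ x) := by gcongr
    _ = _ := by ring

/-- The weak formulation tested with `η(t) ψ(x)`. -/
theorem IsWeakSolution.integral_le {n : ℕ} {β σ p T : ℝ} {u₀ u₁ : L2 n}
    {u : ℝ → E n → ℝ} (hu : IsWeakSolution β σ p u₀ u₁ T u) {ψ : E n → ℝ} {Ψ W : L2 n}
    (hΨψ : Ψ =ᵐ[volume] ψ) (hψ0 : ∀ x, 0 ≤ ψ x) (hΨ : MemH2 Ψ) (hW : IsFracLap (σ / 2) Ψ W)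
    {B D : ℝ} (hB : ∀ᵐ x, |W x| ≤ B * ψ x) (hD : ∀ᵐ x, |lapl Ψ x| ≤ D * ψ x)
    {η : ℝ → ℝ} (hη : ContDiff ℝ ∞ η) (hη0 : ∀ t, 0 ≤ η t) (hT : ∀ t, T < t → η t = 0)
    (h0 : η 0 = 1) (h0' : deriv η 0 = 0) :
    (∫ t in Ioo 0 T, η t * ∫ x, |u t x| ^ p * ψ x) + (∫ x, u₁ x * ψ x) + (∫ x, u₀ x * W x)
      ≤ ∫ t in Ioo 0 T, (|deriv (deriv η) t| + 1 / (1 + t) ^ β * |deriv η t| * B + η t * D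
          + |β| / (1 + t) ^ (β + 1) * η t * B) * ∫ x, |u t x| * ψ x := by
  have hη' : ContDiff ℝ ∞ (deriv η) := (contDiff_infty_iff_deriv.1 hη).2
  have hη'' : ContDiff ℝ ∞ (deriv (deriv η)) := (contDiff_infty_iff_deriv.1 hη').2
  set b : ℝ → ℝ := fun t => ∫ x, |u t x| * ψ x with hb
  have hbΨ : ∀ t, ∫ x, |u t x| * Ψ x = b t := fun t => by
    refine integral_congr_ae ?_
    filter_upwards [hΨψ] with x hx
    rw [hx]
  have hbint : IntegrableOn b (Ioo 0 T) := by
    have := (hu.integrable_abs_mul Ψ).integral_prod_left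
    simp only [hbΨ] at this
    exact this
  have hbx : ∀ᵐ t ∂(volume.restrict (Ioo 0 T)), Integrable fun x => |u t x| * ψ x := by
    filter_upwards [(hu.integrable_abs_mul Ψ).prod_right_ae] with t ht
    refine ht.congr ?_
    filter_upwards [hΨψ] with x hx
    rw [hx]
  have hcoef : ∀ {c : ℝ → ℝ}, ContinuousOn c (Icc 0 T) →
      IntegrableOn (fun t => c t * b t) (Ioo 0 T) := by
    intro c hc
    -- The closed interval is compact, so a continuous coefficient is bounded on it.
    rw [← integrableOn_Icc_iff_integrableOn_Ioo] at hbint ⊢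
    exact hbint.continuousOn_mul hc isCompact_Icc
  have hest : ∀ {c : ℝ → ℝ} {F : ℝ → ℝ}, ContinuousOn c (Icc 0 T) →
      (∀ᵐ t ∂(volume.restrict (Ioo 0 T)), |F t| ≤ c t * b t) →
      |∫ t in Ioo 0 T, F t| ≤ ∫ t in Ioo 0 T, c t * b t := by
    intro c F hc hF
    rw [← Real.norm_eq_abs]
    exact norm_integral_le_of_norm_le (hcoef hc) hF
  have hpos : ∀ᵐ t ∂(volume.restrict (Ioo 0 T)), 0 < t := by
    filter_upwards [ae_restrict_mem measurableSet_Ioo] with t ht using ht.1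
  have cpow : ∀ γ : ℝ, ContinuousOn (fun t : ℝ => (1 + t) ^ γ) (Icc 0 T) := by
    intro γ t ht
    have : 1 + t ≠ 0 := by linarith [ht.1]
    exact ((by fun_prop : ContinuousAt (fun t : ℝ => 1 + t) t).rpow_const
      (Or.inl this)).continuousWithinAt
  have hne : ∀ γ : ℝ, ∀ t ∈ Icc 0 T, (1 + t) ^ γ ≠ 0 := fun γ t ht =>
    (Real.rpow_pos_of_pos (by linarith [ht.1]) γ).ne'
  set φ : ℝ → L2 n := fun t => η t • Ψ with hφ
  have hdt : ∀ t ∈ Ici (0 : ℝ), dt φ t = deriv η t • Ψ := fun t ht =>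
    dt_smul (hη.differentiable (by norm_num)) (fun _ _ => rfl) ht
  have hddt : ∀ t ∈ Ici (0 : ℝ), dt (dt φ) t = deriv (deriv η) t • Ψ := fun t ht =>
    dt_smul (hη'.differentiable (by norm_num)) hdt ht
  have hweak := hu.weak φ (isTestFunction_smul hΨ hW hη hT)
  have smulae : ∀ (c : ℝ) (V : L2 n) {A : ℝ}, (∀ᵐ x, |V x| ≤ A * ψ x) →
      ∀ᵐ x, |(c • V : L2 n) x| ≤ (|c| * A) * ψ x := by
    intro c V A hV
    filter_upwards [Lp.coeFn_smul c V, hV] with x hx hx'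
    rw [hx, Pi.smul_apply, smul_eq_mul, abs_mul, mul_assoc]
    gcongr
  have hΨb : ∀ᵐ x, |Ψ x| ≤ 1 * ψ x := by
    filter_upwards [hΨψ] with x hx
    rw [hx, one_mul, abs_of_nonneg (hψ0 x)]
  have t0 : (∫ t in Ioo 0 T, ∫ x, |u t x| ^ p * φ t x)
      = ∫ t in Ioo 0 T, η t * ∫ x, |u t x| ^ p * ψ x := by
    congr 1; ext t
    rw [← integral_const_mul]
    refine integral_congr_ae ?_
    filter_upwards [Lp.coeFn_smul (η t) Ψ, hΨψ] with x hx hx'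
    rw [hφ, hx, Pi.smul_apply, smul_eq_mul, hx']
    ring
  have t1 : (∫ x, u₁ x * φ 0 x) = ∫ x, u₁ x * ψ x := by
    refine integral_congr_ae ?_
    filter_upwards [hΨψ] with x hx
    simp only [hφ, h0, one_smul, hx]
  have t2 : fracLap (σ / 2) (φ 0) = W := by
    simp only [hφ, h0, one_smul]
    exact fracLap_eq hW
  -- The cutoff is flat at time `0`, so the `u₀ φ_t(0)` term drops out.
  have t3 : (∫ x, u₀ x * dt φ 0 x) = 0 := by
    rw [hdt 0 self_mem_Ici, h0', zero_smul]
    have : ∀ᵐ x, u₀ x * (0 : L2 n) x = (fun _ => 0) x := by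
      filter_upwards [Lp.coeFn_zero ℝ 2 (volume : Measure (E n))] with x hx
      rw [hx]; simp
    rw [integral_congr_ae this]
    simp
  have r1 := hest (c := fun t => |deriv (deriv η) t|)
    (F := fun t => ∫ x, u t x * dt (dt φ) t x) hη''.continuous.abs.continuousOn (by
      filter_upwards [hpos, hbx] with t ht hbt
      rw [hddt t ht.le]
      simpa using abs_integral_mul_le hbt (smulae (deriv (deriv η) t) Ψ hΨb))
  have r2 := hest (c := fun t => 1 / (1 + t) ^ β * |deriv η t| * B)
    (F := fun t => 1 / (1 + t) ^ β * ∫ x, u t x * fracLap (σ / 2) (dt φ t) x)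
    (((continuousOn_const.div (cpow β) (hne β)).mul hη'.continuous.abs.continuousOn).mul
      continuousOn_const) (by
      filter_upwards [hpos, hbx] with t ht hbt
      rw [hdt t ht.le, fracLap_eq (hW.const_smul _), abs_mul, abs_of_nonneg (by positivity),
        mul_assoc, mul_assoc, ← mul_assoc (|deriv η t|)]
      gcongr
      exact abs_integral_mul_le hbt (smulae (deriv η t) W hB))
  have r3 := hest (c := fun t => η t * D)
    (F := fun t => ∫ x, u t x * lapl (φ t) x)
    (hη.continuous.continuousOn.mul continuousOn_const) (by
      filter_upwards [hbx] with t hbt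
      rw [hφ, hΨ.lapl_smul]
      simpa [abs_of_nonneg (hη0 t)] using abs_integral_mul_le hbt (smulae (η t) _ hD))
  have r4 := hest (c := fun t => |β| / (1 + t) ^ (β + 1) * η t * B)
    (F := fun t => β / (1 + t) ^ (β + 1) * ∫ x, u t x * fracLap (σ / 2) (φ t) x)
    (((continuousOn_const.div (cpow (β + 1)) (hne (β + 1))).mul hη.continuous.continuousOn).mul
      continuousOn_const) (by
      filter_upwards [hpos, hbx] with t ht hbt
      have h1 : 0 ≤ (1 + t) ^ (β + 1) := by positivity
      rw [hφ, fracLap_eq (hW.const_smul _), abs_mul, abs_div, abs_of_nonneg h1,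
        mul_assoc, mul_assoc, ← mul_assoc (η t)]
      gcongr
      simpa [abs_of_nonneg (hη0 t)] using abs_integral_mul_le hbt (smulae (η t) W hB))
  have i1 := hcoef (c := fun t => |deriv (deriv η) t|) hη''.continuous.abs.continuousOn
  have i2 := hcoef (c := fun t => 1 / (1 + t) ^ β * |deriv η t| * B)
    (((continuousOn_const.div (cpow β) (hne β)).mul hη'.continuous.abs.continuousOn).mul
      continuousOn_const)
  have i3 := hcoef (c := fun t => η t * D) (hη.continuous.continuousOn.mul continuousOn_const)
  have i4 := hcoef (c := fun t => |β| / (1 + t) ^ (β + 1) * η t * B)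
    (((continuousOn_const.div (cpow (β + 1)) (hne (β + 1))).mul hη.continuous.continuousOn).mul
      continuousOn_const)
  have hsum : ∫ t in Ioo 0 T, (|deriv (deriv η) t| + 1 / (1 + t) ^ β * |deriv η t| * B + η t * D
          + |β| / (1 + t) ^ (β + 1) * η t * B) * b t
      = (∫ t in Ioo 0 T, |deriv (deriv η) t| * b t)
        + (∫ t in Ioo 0 T, 1 / (1 + t) ^ β * |deriv η t| * B * b t)
        + (∫ t in Ioo 0 T, η t * D * b t)
        + ∫ t in Ioo 0 T, |β| / (1 + t) ^ (β + 1) * η t * B * b t := by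
    have i12 : IntegrableOn (fun t => |deriv (deriv η) t| * b t
      + 1 / (1 + t) ^ β * |deriv η t| * B * b t) (Ioo 0 T) := i1.add i2
    have i123 : IntegrableOn (fun t => |deriv (deriv η) t| * b t
      + 1 / (1 + t) ^ β * |deriv η t| * B * b t + η t * D * b t) (Ioo 0 T) := i12.add i3
    rw [← integral_add i1 i2, ← integral_add i12 i3, ← integral_add i123 i4]
    congr 1; ext t
    ring
  rw [hsum]
  rw [t0, t1, t2, t3] at hweak
  have := abs_le.1 r1
  have := abs_le.1 r2
  have := abs_le.1 r3
  have := abs_le.1 r4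
  linarith

/-! ### Young's inequality and the scaling of the remainders. -/

/-- Young's inequality for the factors `(c e)^(1/p) |v|` and `c^(-1/p) h`, using `q/p = q - 1`. In
the application `e` is the value of the cutoff, and `c` is the free weight that will be sent to
infinity. -/
theorem young_integral_le {n : ℕ} {p q : ℝ} (hpq : p.HolderConjugate q) {v ψ : E n → ℝ}
    (hψ0 : ∀ x, 0 ≤ ψ x) (hψ : Integrable ψ) (h1 : Integrable fun x => |v x| ^ p * ψ x)
    (h2 : Integrable fun x => |v x| * ψ x) {e h c : ℝ} (he : 0 ≤ e) (hh : 0 ≤ h) (hc : 0 < c) :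
    h * e ^ (1 / p) * (∫ x, |v x| * ψ x)
      ≤ c * (e * ∫ x, |v x| ^ p * ψ x) + c ^ (1 - q) * h ^ q * ∫ x, ψ x := by
  have hp0 := hpq.pos
  have hq0 := hpq.symm.pos
  rw [← integral_const_mul, ← mul_assoc, ← integral_const_mul, ← integral_const_mul,
    ← integral_add (h1.const_mul _) (hψ.const_mul _)]
  refine integral_mono (h2.const_mul _) ((h1.const_mul _).add (hψ.const_mul _)) fun x => ?_
  have hv : 0 ≤ |v x| := abs_nonneg _
  have hcp : 0 < c ^ (1 / p) := by positivity
  have hy := Real.young_inequality_of_nonneg (a := c ^ (1 / p) * e ^ (1 / p) * |v x|)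
    (b := (c ^ (1 / p))⁻¹ * h) (by positivity) (by positivity) hpq
  have e1 : (c ^ (1 / p) * e ^ (1 / p) * |v x|) ^ p = c * e * |v x| ^ p := by
    rw [Real.mul_rpow (by positivity) hv, Real.mul_rpow hcp.le (by positivity),
      ← Real.rpow_mul hc.le, ← Real.rpow_mul he, one_div_mul_cancel hp0.ne', Real.rpow_one,
      Real.rpow_one]
  have e2 : ((c ^ (1 / p))⁻¹ * h) ^ q = c ^ (1 - q) * h ^ q := by
    rw [Real.mul_rpow (by positivity) hh, ← Real.rpow_neg hc.le, ← Real.rpow_mul hc.le]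
    congr 2
    have := hpq.symm.sub_one_mul_conj
    field_simp
    linarith
  have e3 : c ^ (1 / p) * e ^ (1 / p) * |v x| * ((c ^ (1 / p))⁻¹ * h)
      = h * e ^ (1 / p) * |v x| := by
    field_simp
  rw [e1, e2, e3] at hy
  have b1 : c * e * |v x| ^ p / p ≤ c * e * |v x| ^ p := div_le_self (by positivity) hpq.lt.le
  have b2 : c ^ (1 - q) * h ^ q / q ≤ c ^ (1 - q) * h ^ q :=
    div_le_self (by positivity) hpq.symm.lt.le
  simp only
  calc _ = (h * e ^ (1 / p) * |v x|) * ψ x := by ring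
    _ ≤ (c * e * |v x| ^ p + c ^ (1 - q) * h ^ q) * ψ x := by
        gcongr
        · exact hψ0 x
        · linarith
    _ = _ := by ring

theorem one_div_one_add_rpow_le {β T t : ℝ} (hT : 1 ≤ T) (h1 : T / 2 ≤ t) (h2 : t ≤ T) :
    1 / (1 + t) ^ β ≤ 2 ^ |β| * T ^ (-β) := by
  have hT0 : 0 < T := by linarith
  have ht : 0 < 1 + t := by linarith
  rw [one_div, ← Real.rpow_neg ht.le]
  rcases le_total 0 β with hβ | hβ
  · rw [abs_of_nonneg hβ]
    calc (1 + t) ^ (-β) ≤ (2⁻¹ * T) ^ (-β) :=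
          Real.rpow_le_rpow_of_nonpos (by positivity) (by linarith) (by linarith)
      _ = _ := by
          rw [Real.mul_rpow (by norm_num) hT0.le, Real.inv_rpow (by norm_num),
            Real.rpow_neg (by norm_num), inv_inv]
  · rw [abs_of_nonpos hβ, ← Real.mul_rpow (by norm_num) hT0.le]
    exact Real.rpow_le_rpow ht.le (by linarith) (by linarith)

theorem integrableOn_one_add_rpow (a T : ℝ) :
    IntegrableOn (fun t : ℝ => (1 + t) ^ a) (Ioo 0 T) := by
  rw [← integrableOn_Icc_iff_integrableOn_Ioo]
  refine ContinuousOn.integrableOn_Icc fun t ht => ?_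
  have : 1 + t ≠ 0 := by linarith [ht.1]
  exact ((by fun_prop : ContinuousAt (fun t : ℝ => 1 + t) t).rpow_const
    (Or.inl this)).continuousWithinAt

theorem integral_one_add_rpow_le {μ T : ℝ} (hμ : 0 < μ) (hT : 1 ≤ T) :
    ∫ t in Ioo 0 T, (1 + t) ^ (μ - 1) ≤ 2 ^ μ / μ * T ^ μ := by
  have h1 : ∫ t in Ioo 0 T, (1 + t) ^ (μ - 1) = ((1 + T) ^ μ - 1) / μ := by
    rw [← integral_Ioc_eq_integral_Ioo, ← intervalIntegral.integral_of_le (by linarith),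
      intervalIntegral.integral_comp_add_left (fun t => t ^ (μ - 1)),
      integral_rpow (Or.inl (by linarith))]
    simp
  rw [h1, div_mul_eq_mul_div, ← Real.mul_rpow (by norm_num) (by linarith)]
  gcongr
  have : (1 + T) ^ μ ≤ (2 * T) ^ μ := Real.rpow_le_rpow (by linarith) (by linarith) hμ.le
  linarith

theorem inv_mul_rpow_rpow {K T : ℝ} (hK : 0 < K) (hT : 0 < T) (κ a : ℝ) :
    ((K * T ^ κ)⁻¹) ^ a = K ^ (-a) * T ^ (-(κ * a)) := by
  rw [Real.inv_rpow (by positivity), ← Real.rpow_neg (by positivity),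
    Real.mul_rpow hK.le (by positivity), ← Real.rpow_mul hT.le]
  congr 2
  ring

theorem deriv_comp_mul_left_eq {η : ℝ → ℝ} (c : ℝ) :
    deriv (fun t => η (c * t)) = fun t => c * deriv η (c * t) := by
  ext t
  simpa using deriv_comp_mul_left c η t

theorem deriv_deriv_comp_mul_left_eq {η : ℝ → ℝ} (c : ℝ) :
    deriv (deriv fun t => η (c * t)) = fun t => c ^ 2 * deriv (deriv η) (c * t) := by
  rw [deriv_comp_mul_left_eq]
  ext t
  rw [deriv_const_mul_field, deriv_comp_mul_left_eq]
  ring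

theorem integral_scaled {n : ℕ} (ψ : E n → ℝ) {K T κ : ℝ} (hK : 0 < K) (hT : 0 < T) :
    ∫ x, ψ ((K * T ^ κ)⁻¹ • x) = K ^ (n : ℝ) * T ^ (κ * n) * ∫ x, ψ x := by
  have h : 0 < K * T ^ κ := by positivity
  rw [Measure.integral_comp_smul, finrank_euclideanSpace_fin, smul_eq_mul,
    abs_of_pos (by positivity), inv_pow, inv_inv, mul_pow, ← Real.rpow_natCast,
    ← Real.rpow_natCast, ← Real.rpow_mul hT.le]

/-- The first two coefficients of the weak formulation are supported in `t ≥ T/2` and of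
size `T⁻²`. -/
theorem IsCutoff.coeff_le {p C₀ : ℝ} {η : ℝ → ℝ} (hη : IsCutoff p C₀ η) {β σ κ A K T t : ℝ}
    (hσ : 0 < σ) (hκσ : 1 - β ≤ σ * κ) (hA : 0 ≤ A) (hT : 1 ≤ T) (hK : 1 ≤ K) (ht : 0 < t)
    (htT : t ≤ T) :
    |deriv (deriv fun t => η (T⁻¹ * t)) t|
        + 1 / (1 + t) ^ β * |deriv (fun t => η (T⁻¹ * t)) t| * (A * ((K * T ^ κ)⁻¹) ^ σ)
      ≤ (if T / 2 ≤ t then C₀ * (1 + 2 ^ |β| * A) * T ^ (-2 : ℝ) else 0)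
        * η (T⁻¹ * t) ^ (1 / p) := by
  have hT0 : 0 < T := by linarith
  rw [deriv_deriv_comp_mul_left_eq, deriv_comp_mul_left_eq]
  simp only
  split_ifs with h
  · have hC := hη.const_nonneg
    -- The hypothesis `1 - β ≤ σ κ` is what makes the damping term no larger than `T⁻²`.
    have hr : ((K * T ^ κ)⁻¹) ^ σ ≤ T ^ (β - 1) := by
      rw [inv_mul_rpow_rpow (by linarith) hT0]
      calc K ^ (-σ) * T ^ (-(κ * σ)) ≤ 1 * T ^ (β - 1) := by
            gcongr
            · exact Real.rpow_le_one_of_one_le_of_nonpos hK (by linarith)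
            · linarith
        _ = _ := one_mul _
    have hb := one_div_one_add_rpow_le (β := β) hT h htT
    have h0 : 0 ≤ η (T⁻¹ * t) ^ (1 / p) := Real.rpow_nonneg (hη.nonneg _) _
    have e2 : T ^ (-2 : ℝ) = T⁻¹ ^ 2 := by
      rw [Real.rpow_neg hT0.le]; norm_cast; simp
    have e3 : T ^ (-β) * T⁻¹ * T ^ (β - 1) = T ^ (-2 : ℝ) := by
      rw [← Real.rpow_neg_one, ← Real.rpow_add hT0, ← Real.rpow_add hT0]
      congr 1; ring
    rw [abs_mul, abs_mul, abs_of_pos (by positivity : 0 < T⁻¹ ^ 2),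
      abs_of_pos (by positivity : 0 < T⁻¹)]
    have hpow : 0 ≤ 1 / (1 + t) ^ β := by positivity
    calc _ ≤ T⁻¹ ^ 2 * (C₀ * η (T⁻¹ * t) ^ (1 / p))
          + 2 ^ |β| * T ^ (-β) * (T⁻¹ * (C₀ * η (T⁻¹ * t) ^ (1 / p))) * (A * T ^ (β - 1)) := by
          gcongr
          · exact hη.deriv_deriv_le _
          · exact hη.deriv_le _
      _ = T⁻¹ ^ 2 * (C₀ * η (T⁻¹ * t) ^ (1 / p))
          + 2 ^ |β| * C₀ * A * (T ^ (-β) * T⁻¹ * T ^ (β - 1)) * η (T⁻¹ * t) ^ (1 / p) := by ring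
      _ = _ := by rw [e3, e2]; ring
  · have hs : T⁻¹ * t < 1 / 2 := by
      rw [inv_mul_lt_iff₀ hT0]; linarith
    rw [hη.deriv_eq_zero _ hs, hη.deriv_deriv_eq_zero _ hs]
    simp

theorem integrable_sections_of_ae_eq {n : ℕ} {μ : Measure ℝ} [SFinite μ] {v : ℝ → E n → ℝ}
    {Ψ ψ : E n → ℝ} (h : Integrable (fun z : ℝ × E n => v z.1 z.2 * Ψ z.2) (μ.prod volume))
    (hΨ : Ψ =ᵐ[volume] ψ) :
    (∀ᵐ t ∂μ, Integrable fun x => v t x * ψ x) ∧ Integrable (fun t => ∫ x, v t x * ψ x) μ := by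
  have e : ∀ t, (fun x => v t x * Ψ x) =ᵐ[volume] fun x => v t x * ψ x := fun t => by
    filter_upwards [hΨ] with x hx
    rw [hx]
  constructor
  · filter_upwards [h.prod_right_ae] with t ht
    exact ht.congr (e t)
  · exact h.integral_prod_left.congr (Eventually.of_forall fun t => integral_congr_ae (e t))

theorem rpow_two_eq (r : ℝ) : r ^ 2 = r ^ (2 : ℝ) := by norm_cast

/-- The total power of `T`, namely `-2q + κN + 1`, is nonpositive; equality is the critical case,
where only the factor in `c` can give smallness. -/
theorem scaled_time_coeff_le {C c K T m κ q N : ℝ} (hC : 0 ≤ C) (hc : 0 ≤ c) (hT : 1 ≤ T)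
    (hK : 0 ≤ K) (hm : 0 ≤ m) (h : 1 + κ * N ≤ 2 * q) :
    c ^ (1 - q) * (C * T ^ (-2 : ℝ)) ^ q * (K ^ N * T ^ (κ * N) * m) * T
      ≤ C ^ q * m * (c ^ (1 - q) * K ^ N) := by
  have hT0 : 0 < T := by linarith
  have e : c ^ (1 - q) * (C * T ^ (-2 : ℝ)) ^ q * (K ^ N * T ^ (κ * N) * m) * T
      = C ^ q * m * (c ^ (1 - q) * K ^ N) * T ^ (-2 * q + κ * N + 1) := by
    rw [Real.mul_rpow hC (by positivity), ← Real.rpow_mul hT0.le,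
      Real.rpow_add hT0, Real.rpow_add hT0, Real.rpow_one]
    ring
  rw [e]
  refine mul_le_of_le_one_right (by positivity) ?_
  exact Real.rpow_le_one_of_one_le_of_nonpos hT (by linarith)

/-- As `κ ≥ 1`, the scale `K T^κ` makes the Laplacian no worse in `T` than two time derivatives. In
`K` the gain `2q` is weakened to `σq` to match the damping term. -/
theorem scaled_laplacian_coeff_le {d b σ K T m κ q N : ℝ} (hd : 0 ≤ d) (hb : 0 ≤ b) (hT : 1 ≤ T)
    (hK : 1 ≤ K) (hm : 0 ≤ m) (hq : 0 < q) (hκ : 1 ≤ κ) (hσ : σ ≤ 2) (h : 1 + κ * N ≤ 2 * q) :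
    d * (b * ((K * T ^ κ)⁻¹) ^ (2 : ℝ)) ^ q * (K ^ N * T ^ (κ * N) * m) * T
      ≤ d * b ^ q * m * K ^ (-(σ * q - N)) := by
  have hT0 : 0 < T := by linarith
  have hK0 : 0 < K := by linarith
  have hr0 : 0 ≤ (K * T ^ κ)⁻¹ := by positivity
  have e : d * (b * ((K * T ^ κ)⁻¹) ^ (2 : ℝ)) ^ q * (K ^ N * T ^ (κ * N) * m) * T
      = d * b ^ q * m * K ^ (-(2 * q) + N) * T ^ (-(κ * (2 * q)) + κ * N + 1) := by
    rw [Real.mul_rpow hb (by positivity), ← Real.rpow_mul hr0,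
      inv_mul_rpow_rpow hK0 hT0, Real.rpow_add hT0, Real.rpow_add hT0, Real.rpow_one,
      Real.rpow_add hK0]
    ring
  rw [e]
  refine (mul_le_of_le_one_right (by positivity) ?_).trans ?_
  · refine Real.rpow_le_one_of_one_le_of_nonpos hT ?_
    nlinarith [mul_nonneg (sub_nonneg.2 hκ) hq.le]
  · refine mul_le_mul_of_nonneg_left ?_ (by positivity)
    exact Real.rpow_le_rpow_of_exponent_le hK
      (by linarith [mul_nonneg (sub_nonneg.2 hσ) hq.le])

/-- The value of `μ` is the one for which all powers of `T` cancel, leaving only decay in `K`. -/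
theorem scaled_damping_coeff_eq {d b A σ K T m κ q N μ l : ℝ} (hb : 0 ≤ b) (hA : 0 ≤ A)
    (hT : 0 < T) (hK : 0 < K) (hμ : μ = κ * (σ * q - N)) :
    d * (b * (A * ((K * T ^ κ)⁻¹) ^ σ)) ^ q * (K ^ N * T ^ (κ * N) * m) * (l * T ^ μ)
      = d * (b * A) ^ q * m * l * K ^ (-(σ * q - N)) := by
  have hr0 : 0 ≤ (K * T ^ κ)⁻¹ := by positivity
  have e0 : (b * (A * ((K * T ^ κ)⁻¹) ^ σ)) ^ q
      = (b * A) ^ q * (K ^ (-(σ * q)) * T ^ (-(κ * (σ * q)))) := by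
    rw [← mul_assoc, Real.mul_rpow (by positivity) (by positivity), ← Real.rpow_mul hr0,
      inv_mul_rpow_rpow hK hT]
  have e1 : T ^ (-(κ * (σ * q))) * T ^ (κ * N) * T ^ μ = 1 := by
    rw [← Real.rpow_add hT, ← Real.rpow_add hT,
      show -(κ * (σ * q)) + κ * N + μ = 0 by rw [hμ]; ring, Real.rpow_zero]
  have e2 : K ^ (-(σ * q - N)) = K ^ (-(σ * q)) * K ^ N := by
    rw [← Real.rpow_add hK]; congr 1; ring
  rw [e0, e2]
  calc _ = d * (b * A) ^ q * m * l * (K ^ (-(σ * q)) * K ^ N)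
        * (T ^ (-(κ * (σ * q))) * T ^ (κ * N) * T ^ μ) := by ring
    _ = _ := by rw [e1, mul_one]

set_option maxHeartbeats 1000000 in
/-- The a priori estimate obtained from the weak formulation, tested with the cutoff at time `T`
and the profile at scale `K T^κ`. -/
theorem exists_energy_estimate {n : ℕ} (hn : 1 ≤ n) {p q σ β κ A C₀ : ℝ}
    (hpq : p.HolderConjugate q) (hσ₀ : 0 < σ) (hσ₂ : σ < 2) (hκ : 1 ≤ κ) (hκσ : 1 - β ≤ σ * κ)
    (hκq : 1 + n * κ ≤ 2 * q) (hnq : n < σ * q) {ψ : E n → ℝ} (hψ : IsProfile (σ / 2) A ψ)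
    {η : ℝ → ℝ} (hη : IsCutoff p C₀ η) :
    ∃ C, 0 ≤ C ∧ ∀ (u₀ u₁ : L2 n) (u : ℝ → E n → ℝ), Integrable u₀ →
      IsGlobalWeakSolution β σ p u₀ u₁ u → ∀ T K c : ℝ, 1 ≤ T → 1 ≤ K → 0 < c →
      1 / 2 * (∫ t in Ioo 0 T, η (T⁻¹ * t) * ∫ x, |u t x| ^ p * ψ ((K * T ^ κ)⁻¹ • x))
          + ∫ x, u₁ x * ψ ((K * T ^ κ)⁻¹ • x)
        ≤ A * ((K * T ^ κ)⁻¹) ^ σ * (∫ x, |u₀ x|)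
          + c * (∫ t in Ioo 0 T, if T / 2 ≤ t then
              η (T⁻¹ * t) * ∫ x, |u t x| ^ p * ψ ((K * T ^ κ)⁻¹ • x) else 0)
          + C * (c ^ (1 - q) * K ^ (n : ℝ) + K ^ (-(σ * q - n))) := by
  have hq1 : 1 < q := hpq.symm.lt
  have hq0 : 0 < q := hpq.symm.pos
  have hp0 : 0 < p := hpq.pos
  have hA : 0 ≤ A := by
    have h1 := hψ.fderiv_le 0
    rw [hψ.apply_zero, mul_one] at h1
    exact (norm_nonneg _).trans h1
  have hC₀ := hη.const_nonneg
  set m : ℝ := ∫ x, ψ x with hm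
  have hm0 : 0 ≤ m := integral_nonneg fun x => (hψ.pos x).le
  -- `T ^ μ` compensates the power of `T` coming from the spatial scale; `μ > 0` makes `(1 + t) ^ (μ
  -- - 1)` integrate to order `T ^ μ`.
  set μ : ℝ := κ * (σ * q - n) with hμ
  have hμ0 : 0 < μ := by
    have : 0 < σ * q - n := by linarith
    positivity
  set C₁ : ℝ := C₀ * (1 + 2 ^ |β| * A) with hC₁
  have hC₁0 : 0 ≤ C₁ := by positivity
  set D₁ : ℝ := C₁ ^ q * m with hD₁
  -- The Laplacian and the term with the derivative of `(1 + t) ^ (-β)` each use Young weight `1/4`;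
  -- together they absorb half of the main integral.
  set D₂ : ℝ := (1 / 4) ^ (1 - q) * (n * A) ^ q * m with hD₂
  set D₃ : ℝ := (1 / 4) ^ (1 - q) * (|β| * A) ^ q * m * (2 ^ μ / μ) with hD₃
  have hD₁0 : 0 ≤ D₁ := by positivity
  have hD₂0 : 0 ≤ D₂ := by positivity
  have hD₃0 : 0 ≤ D₃ := by positivity
  refine ⟨D₁ + (D₂ + D₃), by positivity, fun u₀ u₁ u hu₀ hu T K c hT hK hc => ?_⟩
  have hT0 : 0 < T := by linarith
  have hK0 : 0 < K := by linarith
  set r : ℝ := (K * T ^ κ)⁻¹ with hr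
  have hr0 : 0 < r := by positivity
  obtain ⟨Ψ, W, hΨψ, hΨ, hW, hWb, hlb⟩ :=
    hψ.exists_scaled hn (by linarith) (by linarith) hr0
  rw [show 2 * (σ / 2) = σ by ring] at hWb
  set ψr : E n → ℝ := fun x => ψ (r • x) with hψr
  have hψr0 : ∀ x, 0 ≤ ψr x := fun x => (hψ.pos _).le
  have hψri : Integrable ψr := hψ.integrable.comp_smul hr0.ne'
  have hlb' : ∀ᵐ x, |lapl Ψ x| ≤ n * A * r ^ (2 : ℝ) * ψr x := by
    filter_upwards [hlb] with x hx
    refine hx.trans_eq ?_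
    rw [rpow_two_eq]; ring
  set ηT : ℝ → ℝ := fun t => η (T⁻¹ * t) with hηT
  have hηT0 : ∀ t, 0 ≤ ηT t := fun t => hη.nonneg _
  have hηTc : ContDiff ℝ ∞ ηT := hη.contDiff.comp (by fun_prop)
  have huT := hu T hT0
  set a : ℝ → ℝ := fun t => ∫ x, |u t x| ^ p * ψr x with ha
  set b : ℝ → ℝ := fun t => ∫ x, |u t x| * ψr x with hb
  obtain ⟨hax, hai⟩ := integrable_sections_of_ae_eq (v := fun t x => |u t x| ^ p)
    (huT.integrable_abs_rpow_mul hp0 Ψ) hΨψ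
  obtain ⟨hbx, -⟩ := integrable_sections_of_ae_eq (v := fun t x => |u t x|)
    (huT.integrable_abs_mul Ψ) hΨψ
  have ha0 : ∀ t, 0 ≤ a t := fun t => integral_nonneg fun x =>
    mul_nonneg (Real.rpow_nonneg (abs_nonneg _) _) (hψr0 x)
  have hb0 : ∀ t, 0 ≤ b t := fun t => integral_nonneg fun x =>
    mul_nonneg (abs_nonneg _) (hψr0 x)
  have hηai : IntegrableOn (fun t => ηT t * a t) (Ioo 0 T) := by
    refine hai.bdd_mul (c := 1) hηTc.continuous.aestronglyMeasurable
      (Eventually.of_forall fun t => ?_)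
    rw [Real.norm_of_nonneg (hηT0 t)]
    exact hη.le_one _
  have hmain := huT.integral_le hΨψ hψr0 hΨ hW hWb hlb' hηTc hηT0
    (fun t ht => hη.eq_zero _ (by rw [le_inv_mul_iff₀ hT0]; linarith))
    (by simp only [hηT, mul_zero]; exact hη.eq_one 0 (by norm_num))
    (by simp only [hηT, deriv_comp_mul_left_eq, mul_zero]; rw [hη.deriv_eq_zero 0 (by norm_num),
      mul_zero])
  set M : ℝ := ∫ x, ψr x with hM
  have hMeq : M = K ^ (n : ℝ) * T ^ (κ * n) * m := integral_scaled ψ hK0 hT0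
  have hM0 : 0 ≤ M := integral_nonneg hψr0
  set P₁ : ℝ := c ^ (1 - q) * (C₁ * T ^ (-2 : ℝ)) ^ q * M with hP₁
  set P₂ : ℝ := (1 / 4) ^ (1 - q) * (n * A * r ^ (2 : ℝ)) ^ q * M with hP₂
  set P₃ : ℝ := (1 / 4) ^ (1 - q) * (|β| * (A * r ^ σ)) ^ q * M with hP₃
  have hP₁0 : 0 ≤ P₁ := by positivity
  have hP₂0 : 0 ≤ P₂ := by positivity
  have hP₃0 : 0 ≤ P₃ := by positivity
  set J : ℝ → ℝ := fun t => if T / 2 ≤ t then ηT t * a t else 0 with hJ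
  have hJi : IntegrableOn J (Ioo 0 T) := by
    have : J = (Ici (T / 2)).indicator fun t => ηT t * a t := by
      ext t
      simp [hJ, indicator]
    rw [this]
    exact hηai.indicator measurableSet_Ici
  have hpt : ∀ᵐ t ∂(volume.restrict (Ioo 0 T)),
      (|deriv (deriv ηT) t| + 1 / (1 + t) ^ β * |deriv ηT t| * (A * r ^ σ)
        + ηT t * (n * A * r ^ (2 : ℝ)) + |β| / (1 + t) ^ (β + 1) * ηT t * (A * r ^ σ)) * b t
      ≤ c * J t + 1 / 2 * (ηT t * a t) + (P₁ + P₂) + P₃ * (1 + t) ^ (μ - 1) := by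
    filter_upwards [hax, hbx, ae_restrict_mem measurableSet_Ioo] with t hat hbt ht
    have ht0 : 0 < t := ht.1
    have hyoung : ∀ {h c : ℝ}, 0 ≤ h → 0 < c →
        h * ηT t ^ (1 / p) * b t ≤ c * (ηT t * a t) + c ^ (1 - q) * h ^ q * M := fun hh hc =>
      young_integral_le hpq hψr0 hψri hat hbt (hηT0 t) hh hc
    -- Terms carrying the full cutoff also fit Young's inequality, as `0 ≤ η ≤ 1` and `1 / p ≤ 1`.
    have hle : ηT t ≤ ηT t ^ (1 / p) := by
      refine Real.self_le_rpow_of_le_one (hηT0 t) (hη.le_one _) ?_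
      rw [div_le_one hp0]
      exact hpq.lt.le
    have s1 : (|deriv (deriv ηT) t| + 1 / (1 + t) ^ β * |deriv ηT t| * (A * r ^ σ)) * b t
        ≤ c * J t + P₁ := by
      have h1 := hη.coeff_le hσ₀ hκσ hA hT hK ht0 ht.2.le
      refine (mul_le_mul_of_nonneg_right h1 (hb0 t)).trans ?_
      simp only [hJ]
      split_ifs with hh
      · exact hyoung (by positivity) hc
      · simpa using hP₁0
    have s2 : ηT t * (n * A * r ^ (2 : ℝ)) * b t ≤ 1 / 4 * (ηT t * a t) + P₂ := by
      refine le_trans ?_ (hyoung (h := n * A * r ^ (2 : ℝ)) (by positivity) (by norm_num))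
      have := hb0 t
      rw [mul_comm (ηT t)]
      gcongr
    have s3 : |β| / (1 + t) ^ (β + 1) * ηT t * (A * r ^ σ) * b t
        ≤ 1 / 4 * (ηT t * a t) + P₃ * (1 + t) ^ (μ - 1) := by
      have h1t : 0 < 1 + t := by linarith
      refine le_trans (b := |β| * (A * r ^ σ) * (1 + t) ^ (-(β + 1)) * ηT t ^ (1 / p) * b t) ?_ ?_
      · have := hb0 t
        rw [div_eq_mul_inv, ← Real.rpow_neg h1t.le]
        calc _ = |β| * (A * r ^ σ) * (1 + t) ^ (-(β + 1)) * ηT t * b t := by ring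
          _ ≤ _ := by gcongr
      · refine (hyoung (c := 1 / 4) (by positivity) (by norm_num)).trans ?_
        refine add_le_add le_rfl ?_
        rw [Real.mul_rpow (by positivity) (by positivity), ← Real.rpow_mul h1t.le]
        calc _ = P₃ * (1 + t) ^ (-(β + 1) * q) := by rw [hP₃]; ring
          _ ≤ _ := by
            gcongr
            · linarith
            -- The exponents compare as `μ - 1 = κσq - (κn + 1) ≥ (1 - β)q - 2q = -(β + 1)q`.
            · have := mul_le_mul_of_nonneg_right hκσ hq0.le
              rw [hμ]
              nlinarith
    linarith
  have hRi : IntegrableOn (fun t => c * J t + 1 / 2 * (ηT t * a t) + (P₁ + P₂)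
      + P₃ * (1 + t) ^ (μ - 1)) (Ioo 0 T) := by
    refine (((hJi.const_mul c).add (hηai.const_mul _)).add ?_).add
      ((integrableOn_one_add_rpow _ _).const_mul _)
    exact integrableOn_const (by simp)
  have hup := integral_mono_of_nonneg (μ := volume.restrict (Ioo 0 T)) (by
    filter_upwards [ae_restrict_mem measurableSet_Ioo] with t ht
    have ht0 : 0 < t := ht.1
    have := hb0 t
    have := hηT0 t
    simp only [Pi.zero_apply]
    positivity) hRi hpt
  have hRint : ∫ t in Ioo 0 T, (c * J t + 1 / 2 * (ηT t * a t) + (P₁ + P₂)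
        + P₃ * (1 + t) ^ (μ - 1))
      = c * (∫ t in Ioo 0 T, J t) + 1 / 2 * (∫ t in Ioo 0 T, ηT t * a t) + (P₁ + P₂) * T
        + P₃ * ∫ t in Ioo 0 T, (1 + t) ^ (μ - 1) := by
    have j1 : IntegrableOn (fun t => c * J t) (Ioo 0 T) := hJi.const_mul c
    have j2 : IntegrableOn (fun t => 1 / 2 * (ηT t * a t)) (Ioo 0 T) := hηai.const_mul _
    have j3 : IntegrableOn (fun _ : ℝ => P₁ + P₂) (Ioo 0 T) := integrableOn_const (by simp)
    have j4 : IntegrableOn (fun t : ℝ => P₃ * (1 + t) ^ (μ - 1)) (Ioo 0 T) :=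
      (integrableOn_one_add_rpow _ _).const_mul _
    have j12 : IntegrableOn (fun t => c * J t + 1 / 2 * (ηT t * a t)) (Ioo 0 T) := j1.add j2
    have j123 : IntegrableOn (fun t => c * J t + 1 / 2 * (ηT t * a t) + (P₁ + P₂)) (Ioo 0 T) :=
      j12.add j3
    rw [integral_add j123 j4, integral_add j12 j3, integral_add j1 j2, integral_const_mul,
      integral_const_mul, integral_const_mul, setIntegral_const]
    simp only [smul_eq_mul, Measure.real, Real.volume_Ioo, sub_zero, ENNReal.toReal_ofReal hT0.le]
    ring
  have q1 : P₁ * T ≤ D₁ * (c ^ (1 - q) * K ^ (n : ℝ)) := by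
    rw [hP₁, hD₁, hMeq]
    exact scaled_time_coeff_le hC₁0 hc.le hT hK0.le hm0 (by linarith)
  have q2 : P₂ * T ≤ D₂ * K ^ (-(σ * q - n)) := by
    rw [hP₂, hD₂, hMeq]
    exact scaled_laplacian_coeff_le (by positivity) (by positivity) hT hK hm0 hq0 hκ hσ₂.le
      (by linarith)
  have q3 : P₃ * ∫ t in Ioo 0 T, (1 + t) ^ (μ - 1) ≤ D₃ * K ^ (-(σ * q - n)) := by
    refine (mul_le_mul_of_nonneg_left (integral_one_add_rpow_le hμ0 hT) hP₃0).trans_eq ?_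
    rw [hP₃, hD₃, hMeq]
    exact scaled_damping_coeff_eq (abs_nonneg β) hA hT0 hK0 hμ
  have hu0 : |∫ x, u₀ x * W x| ≤ A * r ^ σ * ∫ x, |u₀ x| := by
    rw [← integral_const_mul, ← Real.norm_eq_abs]
    refine norm_integral_le_of_norm_le (hu₀.abs.const_mul _) ?_
    filter_upwards [hWb] with x hx
    rw [Real.norm_eq_abs, abs_mul, mul_comm]
    gcongr
    refine hx.trans (mul_le_of_le_one_right (by positivity) (hψ.le_one _))
  have hu0' := (abs_le.1 hu0).1
  rw [hRint] at hup
  have n1 : 0 ≤ c ^ (1 - q) * K ^ (n : ℝ) := by positivity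
  have n2 : 0 ≤ K ^ (-(σ * q - n)) := by positivity
  have n3 : D₁ * (c ^ (1 - q) * K ^ (n : ℝ)) + D₂ * K ^ (-(σ * q - n)) + D₃ * K ^ (-(σ * q - n))
      ≤ (D₁ + (D₂ + D₃)) * (c ^ (1 - q) * K ^ (n : ℝ) + K ^ (-(σ * q - n))) := by
    nlinarith [mul_nonneg hD₁0 n2, mul_nonneg hD₂0 n1, mul_nonneg hD₃0 n1]
  linarith

/-! ### From the ranges of `p` to the scaling exponent. -/

/-- Clearing the denominator absorbs the convention about infinity: for `b ≤ 0` the product is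
nonpositive anyway. -/
theorem mul_lt_of_ofReal_lt_divPos {a b p : ℝ} (hp : 0 < p) (ha : 0 < a)
    (h : ENNReal.ofReal p < divPos a b) : p * b < a := by
  rcases le_or_gt b 0 with hb | hb
  · nlinarith
  · unfold divPos at h
    rw [max_eq_right hb.le, ENNReal.lt_div_iff_mul_lt (by simp [hb]) (by simp),
      ← ENNReal.ofReal_mul hp.le, ENNReal.ofReal_lt_ofReal_iff ha] at h
    exact h

/-- The conditions on the exponents in terms of the scaling exponent `κ`. -/
theorem exists_scaling_exponent {n : ℕ} (hn : 1 ≤ n) {β σ p : ℝ} (hσ₀ : 0 < σ) (hp : 1 < p)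
    (hrange :
      (1 - β ≤ σ ∧
        ENNReal.ofReal p < min (divPos (n + 1) (n - 1)) (divPos n (n - σ))) ∨
      (σ ≤ 1 - β ∧
        ENNReal.ofReal p < min (divPos (n * (1 - β) + σ) (n * (1 - β) - σ))
          (divPos n (n - σ))) ∨
      (1 - β ≤ σ ∧ 2 * (n : ℝ) / (n + 1) < σ ∧ 2 ≤ n ∧ p = ((n : ℝ) + 1) / (n - 1)) ∨
      (n * (1 + β) < σ ∧ σ ≤ 1 - β ∧ p = (n * (1 - β) + σ) / (n * (1 - β) - σ))) :
    (n : ℝ) < σ * (p / (p - 1)) ∧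
      ∃ κ : ℝ, 1 ≤ κ ∧ 1 - β ≤ σ * κ ∧ 1 + n * κ ≤ 2 * (p / (p - 1)) := by
  have hn0 : (0 : ℝ) < n := by exact_mod_cast hn
  have hp0 : 0 < p := by linarith
  have hp1 : 0 < p - 1 := by linarith
  have first : p * (n - σ) < n → (n : ℝ) < σ * (p / (p - 1)) := by
    intro h
    rw [← mul_div_assoc, lt_div_iff₀ hp1]
    linarith
  -- Larger `κ` only hurts `1 + nκ ≤ 2q`, so the best choice is `max 1 ((1 - β) / σ)`: it is `1`
  -- here and `(1 - β) / σ` in the next case.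
  have second : 1 - β ≤ σ → p * (n - 1) ≤ n + 1 →
      ∃ κ : ℝ, 1 ≤ κ ∧ 1 - β ≤ σ * κ ∧ 1 + n * κ ≤ 2 * (p / (p - 1)) := by
    intro h1 h2
    refine ⟨1, le_rfl, by linarith, ?_⟩
    rw [← mul_div_assoc, le_div_iff₀ hp1]
    linarith
  have third : σ ≤ 1 - β → p * (n * (1 - β) - σ) ≤ n * (1 - β) + σ →
      ∃ κ : ℝ, 1 ≤ κ ∧ 1 - β ≤ σ * κ ∧ 1 + n * κ ≤ 2 * (p / (p - 1)) := by
    intro h1 h2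
    refine ⟨(1 - β) / σ, by rwa [one_le_div hσ₀], ?_, ?_⟩
    · rw [mul_div_cancel₀ _ hσ₀.ne']
    · rw [← mul_div_assoc, ← mul_div_assoc, le_div_iff₀ hp1]
      rw [show 1 + n * (1 - β) / σ = (σ + n * (1 - β)) / σ by field_simp, div_mul_eq_mul_div,
        div_le_iff₀ hσ₀]
      linarith
  rcases hrange with ⟨h1, h2⟩ | ⟨h1, h2⟩ | ⟨h1, h2, h3, h4⟩ | ⟨h1, h2, h3⟩
  · rw [lt_min_iff] at h2
    exact ⟨first (mul_lt_of_ofReal_lt_divPos hp0 hn0 h2.2),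
      second h1 (mul_lt_of_ofReal_lt_divPos hp0 (by positivity) h2.1).le⟩
  · rw [lt_min_iff] at h2
    have : 0 < n * (1 - β) + σ := by
      have : 0 < 1 - β := by linarith
      positivity
    exact ⟨first (mul_lt_of_ofReal_lt_divPos hp0 hn0 h2.2),
      third h1 (mul_lt_of_ofReal_lt_divPos hp0 this h2.1).le⟩
  · have hn2 : (2 : ℝ) ≤ n := by exact_mod_cast h3
    have hn1 : (0 : ℝ) < n - 1 := by linarith
    rw [div_lt_iff₀ (by linarith)] at h2
    refine ⟨first ?_, second h1 ?_⟩
    · rw [h4, div_mul_eq_mul_div, div_lt_iff₀ hn1]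
      nlinarith
    · rw [h4, div_mul_cancel₀ _ hn1.ne']
  · have hN : 0 < n * (1 - β) + σ := by
      have : 0 < 1 - β := by linarith
      positivity
    -- A nonpositive denominator would force `p ≤ 0`; this includes denominator `0`, where the
    -- quotient has value `0`.
    have hd : 0 < n * (1 - β) - σ := by
      by_contra hd
      rw [not_lt] at hd
      have := div_nonpos_of_nonneg_of_nonpos hN.le hd
      linarith
    refine ⟨first ?_, third h2 ?_⟩
    · rw [h3, div_mul_eq_mul_div, div_lt_iff₀ hd]
      nlinarith
    · rw [h3, div_mul_cancel₀ _ hd.ne']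

/-! ### Space-time integrability and passage to the limit. -/

theorem ae_Ioi_of_forall_ae_Ioo {P : ℝ → Prop}
    (h : ∀ T : ℝ, 0 < T → ∀ᵐ t ∂(volume.restrict (Ioo 0 T)), P t) :
    ∀ᵐ t ∂(volume.restrict (Ioi (0 : ℝ))), P t := by
  have : Ioi (0 : ℝ) = ⋃ j : ℕ, Ioo 0 ((j : ℝ) + 1) := by
    ext t
    simp only [mem_Ioi, mem_iUnion, mem_Ioo]
    refine ⟨fun ht => ?_, fun ⟨_, ht⟩ => ht.1⟩
    obtain ⟨j, hj⟩ := exists_nat_ge t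
    exact ⟨j, ht, by linarith⟩
  rw [this, ae_restrict_iUnion_iff]
  exact fun j => h _ (by positivity)

theorem IsGlobalWeakSolution.integrable_sections {n : ℕ} (hn : 1 ≤ n) {β σ p A : ℝ}
    (hσ₀ : 0 < σ) (hσ₂ : σ < 2) (hp : 0 < p) {u₀ u₁ : L2 n} {u : ℝ → E n → ℝ}
    (hu : IsGlobalWeakSolution β σ p u₀ u₁ u) {ψ : E n → ℝ} (hψ : IsProfile (σ / 2) A ψ)
    {r T : ℝ} (hr : 0 < r) (hT : 0 < T) :
    (∀ᵐ t ∂(volume.restrict (Ioo 0 T)), Integrable fun x => |u t x| ^ p * ψ (r • x)) ∧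
      IntegrableOn (fun t => ∫ x, |u t x| ^ p * ψ (r • x)) (Ioo 0 T) := by
  obtain ⟨Ψ, W, hΨψ, -⟩ := hψ.exists_scaled hn (by linarith) (by linarith) hr
  exact integrable_sections_of_ae_eq (v := fun t x => |u t x| ^ p)
    ((hu T hT).integrable_abs_rpow_mul hp Ψ) hΨψ

/-- If `f` is not integrable, its Bochner integral is `0` and the inequality is trivial; so no
measurability has to be checked in the tail estimate. -/
theorem ofReal_integral_le_lintegral {α : Type*} [MeasurableSpace α] {μ : Measure α} {f : α → ℝ}
    (hf : ∀ x, 0 ≤ f x) : ENNReal.ofReal (∫ x, f x ∂μ) ≤ ∫⁻ x, ENNReal.ofReal (f x) ∂μ := by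
  by_cases h : Integrable f μ
  · rw [ofReal_integral_eq_lintegral_ofReal h (Eventually.of_forall hf)]
  · simp [integral_undef h]

theorem IsProfile.tendsto_smul {n : ℕ} {s A : ℝ} {ψ : E n → ℝ} (hψ : IsProfile s A ψ)
    {ι : Type*} {l : Filter ι} {r : ι → ℝ} (hr : Tendsto r l (𝓝 0)) (x : E n) :
    Tendsto (fun i => ψ (r i • x)) l (𝓝 1) := by
  have h1 : Tendsto (fun i => r i • x) l (𝓝 0) := by
    simpa using hr.smul_const x
  have := (hψ.contDiff.continuous.tendsto 0).comp h1
  rwa [hψ.apply_zero] at this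

theorem tendsto_inv_mul_rpow {K κ : ℝ} (hK : 0 < K) (hκ : 1 ≤ κ) :
    Tendsto (fun T : ℝ => (K * T ^ κ)⁻¹) atTop (𝓝 0) :=
  tendsto_inv_atTop_zero.comp
    ((tendsto_rpow_atTop (by linarith)).const_mul_atTop hK)

/-- The nonlinearity is integrable in space-time if the localized integrals are bounded. -/
theorem IsGlobalWeakSolution.lintegral_lt_top {n : ℕ} (hn : 1 ≤ n) {β σ p A C₀ κ B : ℝ}
    (hσ₀ : 0 < σ) (hσ₂ : σ < 2) (hp : 0 < p) (hκ : 1 ≤ κ) {u₀ u₁ : L2 n} {u : ℝ → E n → ℝ}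
    (hu : IsGlobalWeakSolution β σ p u₀ u₁ u) {ψ : E n → ℝ} (hψ : IsProfile (σ / 2) A ψ)
    {η : ℝ → ℝ} (hη : IsCutoff p C₀ η)
    (hB : ∀ T : ℝ, 1 ≤ T →
      ∫ t in Ioo 0 T, η (T⁻¹ * t) * ∫ x, |u t x| ^ p * ψ ((1 * T ^ κ)⁻¹ • x) ≤ B) :
    ∫⁻ t in Ioi (0 : ℝ), ∫⁻ x, ENNReal.ofReal (|u t x| ^ p) < ⊤ := by
  -- A sequence of times keeps the exceptional null sets countable in number and allows Fatou's
  -- lemma.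
  set τ : ℕ → ℝ := fun k => (k : ℝ) + 1 with hτ
  have hτ1 : ∀ k, 1 ≤ τ k := fun k => by simp [hτ]
  have hτ0 : ∀ k, 0 < τ k := fun k => by linarith [hτ1 k]
  have hτt : Tendsto τ atTop atTop :=
    tendsto_atTop_add_const_right _ _ tendsto_natCast_atTop_atTop
  set r : ℕ → ℝ := fun k => (1 * τ k ^ κ)⁻¹ with hr
  have hr0 : ∀ k, 0 < r k := fun k => by have := hτ0 k; simp only [hr]; positivity
  have hrt : Tendsto r atTop (𝓝 0) := (tendsto_inv_mul_rpow one_pos hκ).comp hτt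
  have hψ0 : ∀ x, 0 ≤ ψ x := fun x => (hψ.pos x).le
  set a : ℕ → ℝ → ℝ := fun k t => ∫ x, |u t x| ^ p * ψ (r k • x) with ha
  have ha0 : ∀ k t, 0 ≤ a k t := fun k t => integral_nonneg fun x =>
    mul_nonneg (Real.rpow_nonneg (abs_nonneg _) _) (hψ0 _)
  have hsec : ∀ᵐ t ∂(volume.restrict (Ioi (0 : ℝ))), AEMeasurable (u t) ∧
      ∀ k, Integrable fun x => |u t x| ^ p * ψ (r k • x) := by
    refine ae_Ioi_of_forall_ae_Ioo fun T hT => ?_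
    have h1 := ae_all_iff.2 fun k => (hu.integrable_sections hn hσ₀ hσ₂ hp hψ (hr0 k) hT).1
    filter_upwards [(hu T hT).meas.prodMk_left, h1] with t h2 h3
    exact ⟨h2.aemeasurable, h3⟩
  set g : ℕ → ℝ → ℝ≥0∞ := fun k =>
    (Ioo 0 (τ k)).indicator fun t => ENNReal.ofReal (η ((τ k)⁻¹ * t) * a k t) with hg
  have hηa : ∀ k, IntegrableOn (fun t => η ((τ k)⁻¹ * t) * a k t) (Ioo 0 (τ k)) := fun k => by
    refine (hu.integrable_sections hn hσ₀ hσ₂ hp hψ (hr0 k) (hτ0 k)).2.bdd_mul (c := 1) ?_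
      (Eventually.of_forall fun t => ?_)
    · exact (hη.contDiff.continuous.comp (by fun_prop)).aestronglyMeasurable
    · rw [Real.norm_of_nonneg (hη.nonneg _)]
      exact hη.le_one _
  have hgm : ∀ k, AEMeasurable (g k) (volume.restrict (Ioi (0 : ℝ))) := fun k => by
    refine AEMeasurable.restrict ?_
    rw [hg, aemeasurable_indicator_iff measurableSet_Ioo]
    exact (hηa k).aestronglyMeasurable.aemeasurable.ennreal_ofReal
  have hgB : ∀ k, ∫⁻ t in Ioi (0 : ℝ), g k t ≤ ENNReal.ofReal B := fun k => by
    calc ∫⁻ t in Ioi (0 : ℝ), g k t ≤ ∫⁻ t, g k t := setLIntegral_le_lintegral _ _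
      _ = ∫⁻ t in Ioo 0 (τ k), ENNReal.ofReal (η ((τ k)⁻¹ * t) * a k t) :=
          lintegral_indicator measurableSet_Ioo _
      _ = ENNReal.ofReal (∫ t in Ioo 0 (τ k), η ((τ k)⁻¹ * t) * a k t) :=
          (ofReal_integral_eq_lintegral_ofReal (hηa k) (Eventually.of_forall fun t =>
            mul_nonneg (hη.nonneg _) (ha0 k t))).symm
      _ ≤ ENNReal.ofReal B := ENNReal.ofReal_le_ofReal (hB (τ k) (hτ1 k))
  -- Fatou in `x`: for fixed `t` the cutoff is eventually `1` and the rescaled profiles tend to `1`.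
  -- Fatou in `t` follows at the end.
  have hle : ∀ᵐ t ∂(volume.restrict (Ioi (0 : ℝ))),
      ∫⁻ x, ENNReal.ofReal (|u t x| ^ p) ≤ liminf (fun k => g k t) atTop := by
    filter_upwards [hsec, ae_restrict_mem measurableSet_Ioi] with t ht ht0
    have ht0' : 0 < t := ht0
    have h1 : ∀ x, liminf (fun k => ENNReal.ofReal (|u t x| ^ p * ψ (r k • x))) atTop
        = ENNReal.ofReal (|u t x| ^ p) := fun x => by
      refine Tendsto.liminf_eq (ENNReal.tendsto_ofReal ?_)
      simpa using (hψ.tendsto_smul hrt x).const_mul (|u t x| ^ p)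
    have h2 : ∀ᶠ k in atTop, ∫⁻ x, ENNReal.ofReal (|u t x| ^ p * ψ (r k • x)) = g k t := by
      filter_upwards [hτt.eventually_gt_atTop (2 * t)] with k hk
      have hmem : t ∈ Ioo 0 (τ k) := ⟨ht0', by linarith⟩
      have h3 : η ((τ k)⁻¹ * t) = 1 := hη.eq_one _ (by
        rw [inv_mul_le_iff₀ (hτ0 k)]; linarith)
      rw [hg]
      simp only [indicator_of_mem hmem, h3, one_mul]
      exact (ofReal_integral_eq_lintegral_ofReal (ht.2 k) (Eventually.of_forall fun x =>
        mul_nonneg (Real.rpow_nonneg (abs_nonneg _) _) (hψ0 _))).symm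
    rw [← liminf_congr h2]
    simp_rw [← h1]
    exact lintegral_liminf_le' fun k => (ht.2 k).aestronglyMeasurable.aemeasurable.ennreal_ofReal
  calc _ ≤ ∫⁻ t in Ioi (0 : ℝ), liminf (fun k => g k t) atTop := lintegral_mono_ae hle
    _ ≤ liminf (fun k => ∫⁻ t in Ioi (0 : ℝ), g k t) atTop := lintegral_liminf_le' hgm
    _ ≤ ENNReal.ofReal B := by
        refine liminf_le_of_frequently_le' (Frequently.of_forall hgB)
    _ < ⊤ := ENNReal.ofReal_lt_top

theorem tendsto_lintegral_Ici_zero {F : ℝ → ℝ≥0∞} (hF : ∫⁻ t in Ioi (0 : ℝ), F t < ⊤) :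
    Tendsto (fun T : ℝ => ∫⁻ t in Ioi (0 : ℝ) ∩ Ici (T / 2), F t) atTop (𝓝 0) := by
  -- The tails are the values of the finite measure with density `F` on sets decreasing to the empty
  -- set.
  set ν : Measure ℝ := (volume.restrict (Ioi (0 : ℝ))).withDensity F with hν
  have hfin : ν univ ≠ ⊤ := by
    rw [hν, withDensity_apply _ MeasurableSet.univ, Measure.restrict_univ]
    exact hF.ne
  have h := tendsto_measure_iInter_atTop (μ := ν) (s := fun T : ℝ => Ici (T / 2))
    (fun T => measurableSet_Ici.nullMeasurableSet)
    (fun T T' h => Ici_subset_Ici.2 (by linarith)) ⟨0, measure_ne_top_of_subset (subset_univ _) hfin⟩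
  have hempty : ⋂ T : ℝ, Ici (T / 2) = ∅ := by
    ext t
    simp only [mem_iInter, mem_Ici, mem_empty_iff_false, iff_false, not_forall, not_le]
    exact ⟨2 * t + 2, by linarith⟩
  rw [hempty, measure_empty] at h
  refine h.congr fun T => ?_
  simp only [hν, Function.comp]
  rw [withDensity_apply _ measurableSet_Ici, Measure.restrict_restrict measurableSet_Ici,
    inter_comm]

/-- Nonexistence of global solutions in terms of the scaling exponent `κ`. -/
theorem IsGlobalWeakSolution.integral_nonpos {n : ℕ} (hn : 1 ≤ n) {p q σ β κ : ℝ}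
    (hpq : p.HolderConjugate q) (hσ₀ : 0 < σ) (hσ₂ : σ < 2) (hκ : 1 ≤ κ) (hκσ : 1 - β ≤ σ * κ)
    (hκq : 1 + n * κ ≤ 2 * q) (hnq : n < σ * q) {u₀ u₁ : L2 n} {u : ℝ → E n → ℝ}
    (hu₀ : Integrable u₀) (hu₁ : Integrable u₁) (hu : IsGlobalWeakSolution β σ p u₀ u₁ u) :
    ∫ x, u₁ x ≤ 0 := by
  obtain ⟨A, ψ, hψ⟩ := exists_isProfile hn (s := σ / 2) (by linarith) (by linarith)
  obtain ⟨C₀, η, hη⟩ := exists_isCutoff hpq.lt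
  obtain ⟨C, hC, hest⟩ := exists_energy_estimate hn hpq hσ₀ hσ₂ hκ hκσ hκq hnq hψ hη
  have hp0 : 0 < p := hpq.pos
  have hψ0 : ∀ x, 0 ≤ ψ x := fun x => (hψ.pos x).le
  have hA : 0 ≤ A := by
    have h1 := hψ.fderiv_le 0
    rw [hψ.apply_zero, mul_one] at h1
    exact (norm_nonneg _).trans h1
  have ha0 : ∀ (r t : ℝ), 0 ≤ ∫ x, |u t x| ^ p * ψ (r • x) := fun r t =>
    integral_nonneg fun x => mul_nonneg (Real.rpow_nonneg (abs_nonneg _) _) (hψ0 _)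
  have hηa : ∀ {r T : ℝ}, 0 < r → 0 < T →
      IntegrableOn (fun t => η (T⁻¹ * t) * ∫ x, |u t x| ^ p * ψ (r • x)) (Ioo 0 T) := by
    intro r T hr hT
    refine (hu.integrable_sections hn hσ₀ hσ₂ hp0 hψ hr hT).2.bdd_mul (c := 1) ?_
      (Eventually.of_forall fun t => ?_)
    · exact (hη.contDiff.continuous.comp (by fun_prop)).aestronglyMeasurable
    · rw [Real.norm_of_nonneg (hη.nonneg _)]
      exact hη.le_one _
  have hfin : ∫⁻ t in Ioi (0 : ℝ), ∫⁻ x, ENNReal.ofReal (|u t x| ^ p) < ⊤ := by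
    -- Take `K = 1` and `c = 1/4`: the late-time term is at most the full integral, so `1/2 - 1/4 =
    -- 1/4` of it survives on the left, whence the factor `4`.
    refine hu.lintegral_lt_top hn hσ₀ hσ₂ hp0 hκ hψ hη (B := 4 * (A * (∫ x, |u₀ x|)
      + C * ((1 / 4) ^ (1 - q) + 1) + ∫ x, |u₁ x|)) fun T hT => ?_
    have hT0 : 0 < T := by linarith
    have h := hest u₀ u₁ u hu₀ hu T 1 (1 / 4) hT le_rfl (by norm_num)
    simp only [Real.one_rpow, mul_one] at h
    set r : ℝ := (1 * T ^ κ)⁻¹ with hr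
    have hr0 : 0 < r := by positivity
    have hr1 : r ^ σ ≤ 1 := by
      refine Real.rpow_le_one hr0.le ?_ hσ₀.le
      rw [hr, one_mul]
      exact inv_le_one_of_one_le₀ (Real.one_le_rpow hT (by linarith))
    have hJ : (∫ t in Ioo 0 T, if T / 2 ≤ t then
        η (T⁻¹ * t) * ∫ x, |u t x| ^ p * ψ (r • x) else 0)
        ≤ ∫ t in Ioo 0 T, η (T⁻¹ * t) * ∫ x, |u t x| ^ p * ψ (r • x) := by
      have hnn : ∀ t, 0 ≤ η (T⁻¹ * t) * ∫ x, |u t x| ^ p * ψ (r • x) := fun t =>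
        mul_nonneg (hη.nonneg _) (ha0 r t)
      refine integral_mono_of_nonneg (Eventually.of_forall fun t => ?_) (hηa hr0 hT0)
        (Eventually.of_forall fun t => ?_)
      · simp only [Pi.zero_apply]
        split_ifs
        exacts [hnn t, le_rfl]
      · simp only
        split_ifs
        exacts [le_rfl, hnn t]
    have hu1 : |∫ x, u₁ x * ψ (r • x)| ≤ ∫ x, |u₁ x| := by
      rw [← Real.norm_eq_abs]
      refine norm_integral_le_of_norm_le hu₁.abs (Eventually.of_forall fun x => ?_)
      rw [Real.norm_eq_abs, abs_mul, abs_of_nonneg (hψ0 _)]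
      exact mul_le_of_le_one_right (abs_nonneg _) (hψ.le_one _)
    have hu1' := (abs_le.1 hu1).1
    have hu0 : A * r ^ σ * (∫ x, |u₀ x|) ≤ A * ∫ x, |u₀ x| := by
      refine mul_le_mul_of_nonneg_right ?_ (integral_nonneg fun x => abs_nonneg _)
      exact mul_le_of_le_one_right hA hr1
    linarith
  -- Let `T → ∞` with `K` and `c` fixed: the `u₀` term scales away, the late-time term is a tail of
  -- a finite integral, and the nonnegative main integral is dropped.
  have hlim : ∀ K c : ℝ, 1 ≤ K → 0 < c →
      ∫ x, u₁ x ≤ C * (c ^ (1 - q) * K ^ (n : ℝ) + K ^ (-(σ * q - n))) := by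
    intro K c hK hc
    have hK0 : 0 < K := by linarith
    have hrt := tendsto_inv_mul_rpow hK0 hκ
    have l1 : Tendsto (fun T : ℝ => ∫ x, u₁ x * ψ ((K * T ^ κ)⁻¹ • x)) atTop
        (𝓝 (∫ x, u₁ x)) := by
      refine tendsto_integral_filter_of_dominated_convergence (fun x => |u₁ x|) ?_ ?_ hu₁.abs ?_
      · exact Eventually.of_forall fun T => hu₁.aestronglyMeasurable.mul
          (hψ.contDiff.continuous.comp (by fun_prop)).aestronglyMeasurable
      · refine Eventually.of_forall fun T => Eventually.of_forall fun x => ?_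
        rw [Real.norm_eq_abs, abs_mul, abs_of_nonneg (hψ0 _)]
        exact mul_le_of_le_one_right (abs_nonneg _) (hψ.le_one _)
      · refine Eventually.of_forall fun x => ?_
        simpa using (hψ.tendsto_smul hrt x).const_mul (u₁ x)
    have l2 : Tendsto (fun T : ℝ => A * ((K * T ^ κ)⁻¹) ^ σ * (∫ x, |u₀ x|)
        + c * (∫⁻ t in Ioi (0 : ℝ) ∩ Ici (T / 2), ∫⁻ x, ENNReal.ofReal (|u t x| ^ p)).toReal
        + C * (c ^ (1 - q) * K ^ (n : ℝ) + K ^ (-(σ * q - n)))) atTop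
        (𝓝 (A * 0 * (∫ x, |u₀ x|) + c * 0
          + C * (c ^ (1 - q) * K ^ (n : ℝ) + K ^ (-(σ * q - n))))) := by
      have m1 : Tendsto (fun T : ℝ => ((K * T ^ κ)⁻¹) ^ σ) atTop (𝓝 0) := by
        have := hrt.rpow_const (p := σ) (Or.inr hσ₀.le)
        rwa [Real.zero_rpow hσ₀.ne'] at this
      have m2 := (ENNReal.tendsto_toReal ENNReal.zero_ne_top).comp
        (tendsto_lintegral_Ici_zero hfin)
      exact (((m1.const_mul A).mul_const _).add (m2.const_mul c)).add tendsto_const_nhds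
    rw [mul_zero, zero_mul, mul_zero, zero_add, zero_add] at l2
    refine le_of_tendsto_of_tendsto l1 l2 ?_
    filter_upwards [eventually_ge_atTop 1] with T hT
    have hT0 : 0 < T := by linarith
    have h := hest u₀ u₁ u hu₀ hu T K c hT hK hc
    have hI : 0 ≤ ∫ t in Ioo 0 T, η (T⁻¹ * t) * ∫ x, |u t x| ^ p * ψ ((K * T ^ κ)⁻¹ • x) :=
      integral_nonneg fun t => mul_nonneg (hη.nonneg _) (ha0 _ t)
    have hJ : (∫ t in Ioo 0 T, if T / 2 ≤ t then
        η (T⁻¹ * t) * ∫ x, |u t x| ^ p * ψ ((K * T ^ κ)⁻¹ • x) else 0)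
        ≤ (∫⁻ t in Ioi (0 : ℝ) ∩ Ici (T / 2), ∫⁻ x, ENNReal.ofReal (|u t x| ^ p)).toReal := by
      refine (ENNReal.ofReal_le_iff_le_toReal ?_).1 ?_
      · exact ((lintegral_mono_set inter_subset_left).trans_lt hfin).ne
      refine (ofReal_integral_le_lintegral fun t => ?_).trans ?_
      · split_ifs
        exacts [mul_nonneg (hη.nonneg _) (ha0 _ t), le_rfl]
      have hsub : Ioo 0 T ⊆ Ioi (0 : ℝ) := fun t ht => ht.1
      rw [inter_comm, ← Measure.restrict_restrict measurableSet_Ici,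
        ← lintegral_indicator measurableSet_Ici]
      refine (lintegral_mono fun t => ?_).trans (lintegral_mono_set hsub)
      by_cases ht : T / 2 ≤ t
      · rw [indicator_of_mem (show t ∈ Ici (T / 2) from ht), if_pos ht]
        calc _ ≤ ENNReal.ofReal (∫ x, |u t x| ^ p * ψ ((K * T ^ κ)⁻¹ • x)) :=
              ENNReal.ofReal_le_ofReal (mul_le_of_le_one_left (ha0 _ t) (hη.le_one _))
          _ ≤ ∫⁻ x, ENNReal.ofReal (|u t x| ^ p * ψ ((K * T ^ κ)⁻¹ • x)) :=
              ofReal_integral_le_lintegral fun x =>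
                mul_nonneg (Real.rpow_nonneg (abs_nonneg _) _) (hψ0 _)
          _ ≤ _ := lintegral_mono fun x => ENNReal.ofReal_le_ofReal
              (mul_le_of_le_one_right (Real.rpow_nonneg (abs_nonneg _) _) (hψ.le_one _))
      · rw [if_neg ht]
        simp
    have := mul_le_mul_of_nonneg_left hJ hc.le
    linarith
  -- Now `c → ∞` with `K` fixed; `q > 1` makes `c ^ (1 - q)` vanish. The order matters, since `K ^
  -- n` grows.
  have hK : ∀ K : ℝ, 1 ≤ K → ∫ x, u₁ x ≤ C * K ^ (-(σ * q - n)) := by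
    intro K hK
    have h1 : Tendsto (fun c : ℝ => c ^ (1 - q)) atTop (𝓝 0) := by
      have := tendsto_rpow_neg_atTop (sub_pos.2 hpq.symm.lt)
      simpa using this
    have h2 : Tendsto (fun c : ℝ => C * (c ^ (1 - q) * K ^ (n : ℝ) + K ^ (-(σ * q - n)))) atTop
        (𝓝 (C * (0 * K ^ (n : ℝ) + K ^ (-(σ * q - n))))) :=
      ((h1.mul_const _).add_const _).const_mul C
    rw [zero_mul, zero_add] at h2
    refine ge_of_tendsto h2 ?_
    filter_upwards [eventually_gt_atTop 0] with c hc
    exact hlim K c hK hc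
  -- Finally `K → ∞`, using `n < σ q`.
  have h1 : Tendsto (fun K : ℝ => C * K ^ (-(σ * q - n))) atTop (𝓝 (C * 0)) :=
    (tendsto_rpow_neg_atTop (by linarith)).const_mul C
  rw [mul_zero] at h1
  refine ge_of_tendsto h1 ?_
  filter_upwards [eventually_ge_atTop 1] with K hK'
  exact hK K hK'

end StructDamp

end

theorem theorem1 (n : ℕ) (hn : 1 ≤ n) (β σ p : ℝ) (hσ₀ : 0 < σ) (hσ₂ : σ < 2) (hp : 1 < p)
    (u₀ u₁ : StructDamp.L2 n)
    (hu₀ : Integrable u₀ volume) (hu₀' : StructDamp.MemH1 u₀) (hu₁ : Integrable u₁ volume)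
    (hpos : 0 < ∫ x, u₁ x)
    (hrange :
      -- subcritical ranges
      (1 - β ≤ σ ∧
        ENNReal.ofReal p < min (StructDamp.divPos (n + 1) (n - 1)) (StructDamp.divPos n (n - σ))) ∨
      (σ ≤ 1 - β ∧
        ENNReal.ofReal p < min (StructDamp.divPos (n * (1 - β) + σ) (n * (1 - β) - σ))
          (StructDamp.divPos n (n - σ))) ∨
      -- critical cases
      (1 - β ≤ σ ∧ 2 * (n : ℝ) / (n + 1) < σ ∧ 2 ≤ n ∧ p = ((n : ℝ) + 1) / (n - 1)) ∨
      (n * (1 + β) < σ ∧ σ ≤ 1 - β ∧ p = (n * (1 - β) + σ) / (n * (1 - β) - σ))) :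
    ¬ ∃ u : ℝ → StructDamp.E n → ℝ, StructDamp.IsGlobalWeakSolution β σ p u₀ u₁ u := by
  rintro ⟨u, hu⟩
  obtain ⟨h1, κ, h2, h3, h4⟩ := StructDamp.exists_scaling_exponent hn hσ₀ hp hrange
  have hpq : p.HolderConjugate (p / (p - 1)) := Real.HolderConjugate.conjExponent hp
  exact absurd hpos (not_lt.2 (hu.integral_nonpos hn hpq hσ₀ hσ₂ h2 h3 h4 h1 hu₀ hu₁))
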